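/- For a tempered distribution $u$ on $\mathbb{R}^2$ (variables $(x,t)$) let $\widetilde u(\xi,\tau)$ denote its spacetime Fourier transform, normalized by $\widetilde u(\xi,\tau)=\int_{\mathbb{R}^2} e^{-i(t\tau+x\xi)}u(x,t)\,dx\,dt$. For $s,b\in\mathbb{R}$ let $X^{s,b}$ be the space of those complex-valued tempered distributions $u$ on $\mathbb{R}^2$ for which $\widetilde u$ is a function and $$\|u\|_{X^{s,b}}=\bigl\|(1+|\xi|)^s(1+|\tau-\xi^3|)^b\,\widetilde u(\xi,\tau)\bigr\|_{L^2_{\xi,\tau}}<\infty .$$ For $\rho\ge 0$ let $B_\rho$ be the bilinear operator defined by $$\widetilde{B_\rho(u,v)}(\xi,\tau)=\int_{\mathbb{R}^2}\bigl[\min(|\xi-\xi_1|,|\xi_1|)\bigr]^\rho\,\widetilde u(\xi-\xi_1,\tau-\tau_1)\,\widetilde v(\xi_1,\tau_1)\,d\xi_1\,d\tau_1 .$$ Given $\rho\in[0,3/4)$, there exist $b\in(1/2,1)$ and $C>0$ such that for all $u,v\in X^{0,b}$ the integral above converges absolutely for almost every $(\xi,\tau)$ and defines a tempered distribution $B_\rho(u,v)$,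 and $$\|\partial_x B_\rho(u,v)\|_{X^{0,b-1}}\le C\,\|u\|_{X^{0,b}}\,\|v\|_{X^{0,b}} .$$ -/

import Mathlib

open MeasureTheory SchwartzMap FourierTransform LineDeriv
open scoped ENNReal

noncomputable section

/-- Spacetime `ℝ²` with its Euclidean structure. The first coordinate is the space variable `x`
(dually, the frequency `ξ`), the second one the time variable `t` (dually, `τ`). -/
abbrev Spacetime : Type := WithLp 2 (ℝ × ℝ)

/-- The spacetime Fourier transform
`ũ(ξ, τ) = ∫ e^{-i(tτ + xξ)} u(x, t) dx dt` of the tempered distribution `u` is the function `f`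
of `(ξ, τ)`. Mathlib's `𝓕` has the kernel `e^{-2πi(tτ + xξ)}`, so that
`(𝓕 u)(ξ, τ) = ũ(2πξ, 2πτ)`. Such an `f` is unique up to a null set, if it exists. -/
structure HasSpacetimeFourier (u : 𝓢'(Spacetime, ℂ)) (f : ℝ × ℝ → ℂ) : Prop where
  aestronglyMeasurable : AEStronglyMeasurable f volume
  integrable : ∀ φ : 𝓢(Spacetime, ℂ),
    Integrable (fun p : ℝ × ℝ => f ((2 * Real.pi) • p) * φ (WithLp.toLp 2 p)) volume
  fourier_eq : ∀ φ : 𝓢(Spacetime, ℂ),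
    𝓕 u φ = ∫ p : ℝ × ℝ, f ((2 * Real.pi) • p) * φ (WithLp.toLp 2 p)

/-- The weight `(1 + |ξ|)^s (1 + |τ - ξ³|)^b`, at the point `p = (ξ, τ)`. -/
def bourgainWeight (s b : ℝ) (p : ℝ × ℝ) : ℝ :=
  (1 + |p.1|) ^ s * (1 + |p.2 - p.1 ^ 3|) ^ b

/-- The norm of the Bourgain space `X^{s,b}`: the `L²` norm of
`(1 + |ξ|)^s (1 + |τ - ξ³|)^b ũ(ξ, τ)`. It is `∞` if `ũ` is not a function; otherwise all the
functions `f` over which the infimum is taken agree almost everywhere. -/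
def bourgainNorm (s b : ℝ) (u : 𝓢'(Spacetime, ℂ)) : ℝ≥0∞ :=
  ⨅ (f : ℝ × ℝ → ℂ) (_ : HasSpacetimeFourier u f),
    eLpNorm (fun p => (bourgainWeight s b p : ℂ) * f p) 2 volume

/-- The Bourgain space `X^{s,b}`, as a set of tempered distributions. -/
def bourgainSpace (s b : ℝ) : Set 𝓢'(Spacetime, ℂ) :=
  {u | bourgainNorm s b u < ∞}

/-- The integrand `[min(|ξ - ξ₁|, |ξ₁|)]^ρ f(ξ - ξ₁, τ - τ₁) g(ξ₁, τ₁)`, with `p = (ξ, τ)` and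
`q = (ξ₁, τ₁)`. -/
def bilinearIntegrand (ρ : ℝ) (f g : ℝ × ℝ → ℂ) (p q : ℝ × ℝ) : ℂ :=
  ((min |p.1 - q.1| |q.1| ^ ρ : ℝ) : ℂ) * f (p - q) * g q

/-- The tempered distribution `w` is `B_ρ(u, v)`: its Fourier transform is the function
`∫ [min(|ξ - ξ₁|, |ξ₁|)]^ρ ũ(ξ - ξ₁, τ - τ₁) ṽ(ξ₁, τ₁) dξ₁ dτ₁`, where the integral converges
absolutely for almost every `(ξ, τ)`. -/
def IsBilinear (ρ : ℝ) (u v w : 𝓢'(Spacetime, ℂ)) : Prop :=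
  ∃ f g : ℝ × ℝ → ℂ, HasSpacetimeFourier u f ∧ HasSpacetimeFourier v g ∧
    (∀ᵐ p : ℝ × ℝ, Integrable (bilinearIntegrand ρ f g p) volume) ∧
    HasSpacetimeFourier w (fun p => ∫ q : ℝ × ℝ, bilinearIntegrand ρ f g p q)

/-- The distributional derivative `∂ₓ u` in the space variable. -/
def spaceDeriv (u : 𝓢'(Spacetime, ℂ)) : 𝓢'(Spacetime, ℂ) :=
  ∂_{(WithLp.toLp 2 ((1 : ℝ), (0 : ℝ)) : Spacetime)} u

end

/-! On the Fourier side, put the weights of the three norms into the multiplier and write `x`, `y`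
for the input frequencies, `x + y` for the output frequency and `s₁`, `s₂`, `s` for the modulations.
Since `s - s₁ - s₂ = -3(x + y)xy`, one of the three modulations is at least of the size of `|(x +
y)xy|`, up to the brackets `1 + |·|`. Its decay pays for the derivative and for the factor `min(|x|,
|y|)^ρ`.

With `b = (1 + ε)/2`, this bounds the squared multiplier by three kernels (`multiplier_sq_le`). Each
decays with exponent `1 + ε > 1` in the two modulations that are not dominant, and carries a factor
such as `|x + y||x - y| + √|x + y|`. Integrating in `τ` merges the two decaying weights into one
weight of a quadratic polynomial in the frequency. The first summand of the factor is, up to a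
constant, the derivative of that polynomial, and the second handles a neighbourhood of its vertex,
so the frequency integral is bounded uniformly (`lintegral_quadratic_le`). Cauchy–Schwarz then gives
the `L²` bound (`lintegral_sq_bilinear_le`).

The restriction `ρ < 3/4` comes from comparable frequencies of size `N`, where `|x - y|` may vanish
and only `√N` is available: one needs `N^(2 + 2ρ) ≤ N^(1/2 + 3(1 - ε))`.

For existence of `B_ρ(u, v)`, the same identity bounds the bilinear integral by `|ξ|^(-ρ/2) (1 + |τ
- ξ³|)^(ρ/2)` times the two norms. This is locally integrable and of polynomial growth away from `ξ
= 0`, hence tempered. -/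

/-! ### Pointwise bounds of the multiplier. -/

/-- The degenerate case of the symbol bound: all three frequencies are comparable. -/
lemma sq_mul_rpow_le_of_comparable {N a b c m ρ ε : ℝ} (hN : 1 ≤ N) (ha : N / 4 ≤ a)
    (ha' : a ≤ N) (hb : N / 4 ≤ b) (hc : N / 4 ≤ c) (hm₀ : 0 ≤ m) (hm : m ≤ N) (hρ : 0 ≤ ρ)
    (hε : 0 < ε) (hε' : ε ≤ 1 / 8) (h : 2 * ρ + 12 * ε ≤ 3 / 2) :
    a ^ 2 * m ^ (2 * ρ) ≤ 64 * √N * (a * b * c) ^ (1 - ε) := by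
  have hN0 : 0 < N := by linarith
  have ha0 : 0 ≤ a := by linarith
  have hb0 : 0 ≤ b := by linarith
  have h1 : (N ^ 3 / 64) ^ (1 - ε) ≤ (a * b * c) ^ (1 - ε) := by
    refine Real.rpow_le_rpow (by positivity) ?_ (by linarith)
    calc N ^ 3 / 64 = N / 4 * (N / 4) * (N / 4) := by ring
      _ ≤ a * b * c := by gcongr
  have h2 : N ^ (3 * (1 - ε)) / 64 ≤ (N ^ 3 / 64) ^ (1 - ε) := by
    rw [Real.div_rpow (by positivity) (by norm_num), ← Real.rpow_natCast N 3,
      ← Real.rpow_mul hN0.le]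
    push_cast
    gcongr
    calc (64 : ℝ) ^ (1 - ε) ≤ 64 ^ (1 : ℝ) :=
          Real.rpow_le_rpow_of_exponent_le (by norm_num) (by linarith)
      _ = 64 := Real.rpow_one _
  have h3 : m ^ (2 * ρ) ≤ N ^ (2 * ρ) := Real.rpow_le_rpow hm₀ hm (by linarith)
  calc a ^ 2 * m ^ (2 * ρ) ≤ N ^ 2 * N ^ (2 * ρ) := by
        gcongr
    _ = N ^ (2 + 2 * ρ) := by rw [Real.rpow_add hN0]; norm_num
    -- This is the comparison of powers that forces `ρ < 3/4`: it needs `2ρ + 3ε ≤ 3/2`.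
    _ ≤ N ^ (1 / 2 + 3 * (1 - ε)) := Real.rpow_le_rpow_of_exponent_le hN (by linarith)
    _ = 64 * √N * (N ^ (3 * (1 - ε)) / 64) := by
        rw [Real.rpow_add hN0, Real.sqrt_eq_rpow]; ring
    _ ≤ _ := by gcongr; exact h2.trans h1

lemma min_rpow_le_mul_rpow {a b ρ ε : ℝ} (ha : 1 ≤ a) (hb : 1 ≤ b) (hε : 0 < ε)
    (h : 2 * ρ + 12 * ε ≤ 3 / 2) :
    (min a b) ^ (2 * ρ) ≤ (a * b) ^ (3 / 4 : ℝ) := by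
  have hm : 1 ≤ min a b := le_min ha hb
  calc (min a b) ^ (2 * ρ) ≤ (min a b) ^ (2 * (3 / 4) : ℝ) :=
        Real.rpow_le_rpow_of_exponent_le hm (by linarith)
    _ = ((min a b) ^ 2) ^ (3 / 4 : ℝ) := by
        rw [Real.rpow_mul (by linarith)]; norm_num
    _ ≤ (a * b) ^ (3 / 4 : ℝ) := by
        gcongr
        rw [sq]
        exact mul_le_mul (min_le_left _ _) (min_le_right _ _) (by linarith) (by linarith)

/-- The symbol bound where one of the input frequencies is small. -/
lemma sq_mul_min_rpow_le_of_min_le_one {x y ρ : ℝ} (hρ : 0 ≤ ρ) (h : min |x| |y| ≤ 1) :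
    |x + y| ^ 2 * (min |x| |y|) ^ (2 * ρ) ≤
      64 * (|x + y| * |x - y| + √|x + y|) := by
  have h1 : (min |x| |y|) ^ (2 * ρ) ≤ 1 :=
    Real.rpow_le_one (by positivity) h (by linarith)
  have h2 : |x + y| ^ 2 ≤ 64 * (|x + y| * |x - y| + √|x + y|) := by
    by_cases hd : |x + y| / 2 ≤ |x - y|
    · nlinarith [abs_nonneg (x + y), Real.sqrt_nonneg |x + y|]
    · push Not at hd
      -- Nearly equal inputs, one of them at most `1`: `|x + y| ≤ 2 + |x - y| < 2 + |x + y| / 2`.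
      have h4 : |x + y| ≤ 4 := by
        rcases min_le_iff.1 h with h | h
        · have h6 : |x + y| ≤ 2 * |x| + |x - y| := by
            calc |x + y| = |2 * x - (x - y)| := by ring_nf
              _ ≤ |2 * x| + |x - y| := abs_sub _ _
              _ = _ := by rw [abs_mul, abs_two]
          linarith
        · have h6 : |x + y| ≤ 2 * |y| + |x - y| := by
            calc |x + y| = |2 * y + (x - y)| := by ring_nf
              _ ≤ |2 * y| + |x - y| := abs_add_le _ _
              _ = _ := by rw [abs_mul, abs_two]
          linarith
      obtain ⟨r, hr, hr'⟩ : ∃ r, 0 ≤ r ∧ |x + y| = r ^ 2 :=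
        ⟨√|x + y|, Real.sqrt_nonneg _, (Real.sq_sqrt (abs_nonneg _)).symm⟩
      rw [hr', Real.sqrt_sq hr]
      rw [hr'] at h4
      have hr2 : r ≤ 2 := by nlinarith
      have : r ^ 4 ≤ 8 * r := by
        have : r ^ 3 ≤ 2 ^ 3 := by gcongr
        nlinarith
      have : 0 ≤ r ^ 2 * |x - y| := by positivity
      nlinarith
  calc _ ≤ |x + y| ^ 2 * 1 := by gcongr
    _ ≤ _ := by simpa using h2

/-- The symbol bound for large input frequencies, with the output modulation dominant. -/
lemma sq_mul_min_rpow_le_output {x y ρ ε : ℝ} (hρ : 0 ≤ ρ) (hε : 0 < ε) (hε' : ε ≤ 1 / 8)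
    (h : 2 * ρ + 12 * ε ≤ 3 / 2) (hx : 1 ≤ |x|) (hy : 1 ≤ |y|) :
    |x + y| ^ 2 * (min |x| |y|) ^ (2 * ρ) ≤
      64 * (|x + y| * |x - y| + √|x + y|) * (|x + y| * |x| * |y|) ^ (1 - ε) := by
  have hx1 : 2 * |x| ≤ |x + y| + |x - y| := by
    calc 2 * |x| = |(x + y) + (x - y)| := by
          rw [show x + y + (x - y) = 2 * x by ring, abs_mul, abs_two]
      _ ≤ _ := abs_add_le _ _
  have hy1 : 2 * |y| ≤ |x + y| + |x - y| := by
    calc 2 * |y| = |(x + y) - (x - y)| := by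
          rw [show x + y - (x - y) = 2 * y by ring, abs_mul, abs_two]
      _ ≤ _ := abs_sub _ _
  have hx2 : |x + y| ≤ 2 * |x| + |x - y| := by
    calc |x + y| = |2 * x - (x - y)| := by ring_nf
      _ ≤ |2 * x| + |x - y| := abs_sub _ _
      _ = _ := by rw [abs_mul, abs_two]
  have hy2 : |x + y| ≤ 2 * |y| + |x - y| := by
    calc |x + y| = |2 * y + (x - y)| := by ring_nf
      _ ≤ |2 * y| + |x - y| := abs_add_le _ _
      _ = _ := by rw [abs_mul, abs_two]
  have hP : 0 ≤ (|x + y| * |x| * |y|) ^ (1 - ε) := by positivity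
  -- Either `|x - y|` is large enough to pay for a derivative, or all three frequencies are
  -- comparable to `|x + y|` and only the square root term remains.
  by_cases hd : |x + y| / 2 ≤ |x - y|
  · rcases (abs_nonneg (x + y)).eq_or_lt with h0 | h0
    · rw [← h0]; simp [Real.zero_rpow (show 1 - ε ≠ 0 by linarith)]
    have hm := min_rpow_le_mul_rpow hx hy hε h
    have hxy : 1 ≤ |x| * |y| := by nlinarith
    have h34 : (|x| * |y|) ^ (3 / 4 : ℝ) ≤ (|x| * |y|) ^ (1 - ε) :=
      Real.rpow_le_rpow_of_exponent_le hxy (by linarith)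
    -- Of the two factors `|x + y|`, the power `1 - ε` of one is kept for the resonance product;
    -- this bounds the leftover `|x + y|^ε`. For `|x + y| ≤ 1` it works because `2 ≤ 2|x| ≤ |x + y|
    -- + |x - y| ≤ 3|x - y|`.
    have hε1 : |x + y| ^ ε ≤ 4 * |x - y| := by
      rcases le_total |x + y| 1 with h1 | h1
      · have := Real.rpow_le_one h0.le h1 hε.le
        linarith
      · calc |x + y| ^ ε ≤ |x + y| ^ (1 : ℝ) :=
              Real.rpow_le_rpow_of_exponent_le h1 (by linarith)
          _ = |x + y| := Real.rpow_one _
          _ ≤ _ := by linarith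
    have hs : |x + y| ^ 2 = |x + y| * (|x + y| ^ ε * |x + y| ^ (1 - ε)) := by
      rw [← Real.rpow_add h0]; simp [sq]
    calc |x + y| ^ 2 * (min |x| |y|) ^ (2 * ρ)
        ≤ |x + y| * (4 * |x - y| * |x + y| ^ (1 - ε)) * (|x| * |y|) ^ (1 - ε) := by
          rw [hs]; gcongr; exact hm.trans h34
      _ = 4 * (|x + y| * |x - y|) * (|x + y| * |x| * |y|) ^ (1 - ε) := by
          rw [mul_assoc |x + y| |x| |y|,
            Real.mul_rpow (abs_nonneg (x + y)) (show 0 ≤ |x| * |y| by positivity)]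
          ring
      _ ≤ _ := by
          gcongr
          · norm_num
          · linarith [Real.sqrt_nonneg |x + y|]
  · push Not at hd
    refine (sq_mul_rpow_le_of_comparable (N := |x + y|) (b := |x|) (c := |y|) (by linarith)
      (by linarith [abs_nonneg (x + y)]) le_rfl (by linarith) (by linarith) (by positivity) ?_ hρ hε hε' h).trans ?_
    · exact (min_le_left _ _).trans (by linarith)
    · gcongr
      exact le_add_of_nonneg_left (by positivity)

/-- The symbol bound for large input frequencies, with the modulation of an input dominant. -/
lemma sq_mul_min_rpow_le_input {x y ρ ε : ℝ} (hρ : 0 ≤ ρ) (hε : 0 < ε) (hε' : ε ≤ 1 / 8)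
    (h : 2 * ρ + 12 * ε ≤ 3 / 2) (hx : 1 ≤ |x|) (hy : 1 ≤ |y|) :
    |x + y| ^ 2 * (min |x| |y|) ^ (2 * ρ) ≤
      64 * (|x| * |x + 2 * y| + √|x|) * (|x + y| * |x| * |y|) ^ (1 - ε) := by
  have hx1 : 2 * |x + y| ≤ |x| + |x + 2 * y| := by
    calc 2 * |x + y| = |x + (x + 2 * y)| := by
          rw [show x + (x + 2 * y) = 2 * (x + y) by ring, abs_mul, abs_two]
      _ ≤ _ := abs_add_le _ _
  have hy1 : 2 * |y| ≤ |x| + |x + 2 * y| := by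
    calc 2 * |y| = |x - (x + 2 * y)| := by
          rw [show x - (x + 2 * y) = -(2 * y) by ring, abs_neg, abs_mul, abs_two]
      _ ≤ _ := abs_sub _ _
  have hx2 : |x| ≤ 2 * |x + y| + |x + 2 * y| := by
    calc |x| = |2 * (x + y) - (x + 2 * y)| := by ring_nf
      _ ≤ |2 * (x + y)| + |x + 2 * y| := abs_sub _ _
      _ = _ := by rw [abs_mul, abs_two]
  have hy2 : |x| ≤ 2 * |y| + |x + 2 * y| := by
    calc |x| = |(x + 2 * y) - 2 * y| := by ring_nf
      _ ≤ |x + 2 * y| + |2 * y| := abs_sub _ _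
      _ = _ := by rw [abs_mul, abs_two]; ring
  have hP : 0 ≤ (|x + y| * |x| * |y|) ^ (1 - ε) := by positivity
  by_cases hd : |x| / 2 ≤ |x + 2 * y|
  · rcases (abs_nonneg (x + y)).eq_or_lt with h0 | h0
    · rw [← h0]; simp [Real.zero_rpow (show 1 - ε ≠ 0 by linarith)]
    have hm := min_rpow_le_mul_rpow hx hy hε h
    have hxy : 1 ≤ |x| * |y| := by nlinarith
    have hxy2 : |x + y| ≤ 2 * (|x| * |y|) := by
      have := abs_add_le x y
      nlinarith
    -- Here the leftover power goes into `|x||y|`: the exponents `1/8` and `3/4` add up to `7/8 ≤ 1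
    -- - ε`.
    have hε1 : |x + y| ^ ε ≤ 2 * (|x| * |y|) ^ (1 / 8 : ℝ) := by
      calc |x + y| ^ ε ≤ (2 * (|x| * |y|)) ^ ε := by gcongr
        _ ≤ (2 * (|x| * |y|)) ^ (1 / 8 : ℝ) :=
            Real.rpow_le_rpow_of_exponent_le (by linarith) hε'
        _ = 2 ^ (1 / 8 : ℝ) * (|x| * |y|) ^ (1 / 8 : ℝ) :=
            Real.mul_rpow (by norm_num) (by positivity)
        _ ≤ 2 ^ (1 : ℝ) * (|x| * |y|) ^ (1 / 8 : ℝ) := by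
            gcongr <;> norm_num
        _ = _ := by rw [Real.rpow_one]
    have h78 : (|x| * |y|) ^ (1 / 8 : ℝ) * (|x| * |y|) ^ (3 / 4 : ℝ) ≤
        (|x| * |y|) ^ (1 - ε) := by
      rw [← Real.rpow_add (by linarith)]
      exact Real.rpow_le_rpow_of_exponent_le hxy (by linarith)
    have hs : |x + y| ^ 2 = |x + y| * (|x + y| ^ ε * |x + y| ^ (1 - ε)) := by
      rw [← Real.rpow_add h0]; simp [sq]
    have hxs : |x + y| ≤ |x| * (2 * |x + 2 * y|) := by nlinarith [abs_nonneg (x + 2 * y)]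
    calc |x + y| ^ 2 * (min |x| |y|) ^ (2 * ρ)
        ≤ |x| * (2 * |x + 2 * y|) * (2 * (|x| * |y|) ^ (1 / 8 : ℝ) * |x + y| ^ (1 - ε)) *
            (|x| * |y|) ^ (3 / 4 : ℝ) := by
          rw [hs]; gcongr
      _ = 4 * (|x| * |x + 2 * y|) * |x + y| ^ (1 - ε) *
            ((|x| * |y|) ^ (1 / 8 : ℝ) * (|x| * |y|) ^ (3 / 4 : ℝ)) := by ring
      _ ≤ 4 * (|x| * |x + 2 * y|) * |x + y| ^ (1 - ε) * (|x| * |y|) ^ (1 - ε) := by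
          gcongr
      _ = 4 * (|x| * |x + 2 * y|) * (|x + y| * |x| * |y|) ^ (1 - ε) := by
          rw [mul_assoc |x + y| |x| |y|,
            Real.mul_rpow (abs_nonneg (x + y)) (show 0 ≤ |x| * |y| by positivity)]
          ring
      _ ≤ _ := by
          gcongr
          · norm_num
          · linarith [Real.sqrt_nonneg |x|]
  · push Not at hd
    refine (sq_mul_rpow_le_of_comparable (N := |x|) (b := |x|) (c := |y|) hx (by linarith)
      (by linarith) (by linarith) (by linarith) (by positivity) ?_ hρ hε hε' h).trans ?_
    · exact min_le_left _ _
    · gcongr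
      exact le_add_of_nonneg_left (by positivity)

lemma rpow_mul_neg_rpow_le_one {P J e : ℝ} (hP : 0 ≤ P) (hJ : 0 < J) (h : P ≤ J) (he : 0 ≤ e) :
    P ^ e * J ^ (-e) ≤ 1 := by
  rw [Real.rpow_neg hJ.le, ← div_eq_mul_inv, div_le_one (by positivity)]
  exact Real.rpow_le_rpow hP h he

/-- The output modulation has the weaker decay `1 - ε`. When an input modulation dominates, this
trades the exponents, so that the weak one sits on the dominant modulation and the remaining two
decay integrably. -/
lemma neg_rpow_mul_neg_rpow_le {a b ε : ℝ} (ha : 0 < a) (hab : a ≤ b) (hε : 0 < ε) :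
    a ^ (-(1 - ε)) * b ^ (-(1 + ε)) ≤ a ^ (-(1 + ε)) * b ^ (-(1 - ε)) := by
  have hb : 0 < b := ha.trans_le hab
  have h1 : a ^ (-(1 - ε)) = a ^ (-(1 + ε)) * a ^ (2 * ε) := by
    rw [← Real.rpow_add ha]; ring_nf
  have h2 : b ^ (-(1 - ε)) = b ^ (-(1 + ε)) * b ^ (2 * ε) := by
    rw [← Real.rpow_add hb]; ring_nf
  rw [h1, h2]
  have := Real.rpow_le_rpow ha.le hab (show 0 ≤ 2 * ε by linarith)
  calc a ^ (-(1 + ε)) * a ^ (2 * ε) * b ^ (-(1 + ε))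
      ≤ a ^ (-(1 + ε)) * b ^ (2 * ε) * b ^ (-(1 + ε)) := by gcongr
    _ = _ := by ring

/-- The pointwise bound of the squared multiplier by kernels that decay in two of the three
modulations `s`, `s₁`, `s₂`. -/
lemma multiplier_sq_le {x y s s₁ s₂ ρ ε : ℝ} (hρ : 0 ≤ ρ) (hε : 0 < ε) (hε' : ε ≤ 1 / 8)
    (h : 2 * ρ + 12 * ε ≤ 3 / 2) (hs : s - s₁ - s₂ = -(3 * ((x + y) * x * y))) :
    |x + y| ^ 2 * (min |x| |y|) ^ (2 * ρ) *
        ((1 + |s|) ^ (-(1 - ε)) * (1 + |s₁|) ^ (-(1 + ε)) * (1 + |s₂|) ^ (-(1 + ε))) ≤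
      64 * ((|x + y| * |x - y| + √|x + y|) * ((1 + |s₁|) ^ (-(1 + ε)) * (1 + |s₂|) ^ (-(1 + ε))) +
        (|x| * |x + 2 * y| + √|x|) * ((1 + |s|) ^ (-(1 + ε)) * (1 + |s₂|) ^ (-(1 + ε))) +
        (|y| * |y + 2 * x| + √|y|) * ((1 + |s|) ^ (-(1 + ε)) * (1 + |s₁|) ^ (-(1 + ε)))) := by
  have hJ : 1 ≤ 1 + |s| := by linarith [abs_nonneg s]
  have hJ1 : 1 ≤ 1 + |s₁| := by linarith [abs_nonneg s₁]
  have hJ2 : 1 ≤ 1 + |s₂| := by linarith [abs_nonneg s₂]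
  have hres : 3 * (|x + y| * |x| * |y|) ≤ |s| + |s₁| + |s₂| := by
    calc 3 * (|x + y| * |x| * |y|) = |s - s₁ - s₂| := by
          rw [hs, abs_neg, abs_mul, abs_mul, abs_mul]; norm_num
      _ ≤ |s - s₁| + |s₂| := abs_sub _ _
      _ ≤ _ := by gcongr; exact abs_sub _ _
  have hP : 0 ≤ |x + y| * |x| * |y| := by positivity
  set P := |x + y| * |x| * |y| with hPdef
  set J := 1 + |s| with hJdef
  set J₁ := 1 + |s₁| with hJ1def
  set J₂ := 1 + |s₂| with hJ2def
  set A := |x + y| * |x - y| + √|x + y| with hA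
  set B := |x| * |x + 2 * y| + √|x| with hB
  set C := |y| * |y + 2 * x| + √|y| with hC
  set M := |x + y| ^ 2 * (min |x| |y|) ^ (2 * ρ) with hM
  have hA0 : 0 ≤ A := by positivity
  have hB0 : 0 ≤ B := by positivity
  have hC0 : 0 ≤ C := by positivity
  have tA : 0 ≤ A * (J₁ ^ (-(1 + ε)) * J₂ ^ (-(1 + ε))) := by positivity
  have tB : 0 ≤ B * (J ^ (-(1 + ε)) * J₂ ^ (-(1 + ε))) := by positivity
  have tC : 0 ≤ C * (J ^ (-(1 + ε)) * J₁ ^ (-(1 + ε))) := by positivity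
  have hM0 : 0 ≤ M := by positivity
  -- With a small input frequency no resonance is needed: the first kernel alone suffices.
  rcases le_or_gt (min |x| |y|) 1 with hmin | hmin
  · have h1 : M ≤ 64 * A := sq_mul_min_rpow_le_of_min_le_one hρ hmin
    have h2 : J ^ (-(1 - ε)) ≤ 1 := Real.rpow_le_one_of_one_le_of_nonpos hJ (by linarith)
    calc _ ≤ 64 * A * (1 * J₁ ^ (-(1 + ε)) * J₂ ^ (-(1 + ε))) := by gcongr
      _ = 64 * (A * (J₁ ^ (-(1 + ε)) * J₂ ^ (-(1 + ε)))) := by ring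
      _ ≤ _ := by linarith
  obtain ⟨hx, hy⟩ := lt_min_iff.1 hmin
  -- By `hres`, `3P ≤ J + J₁ + J₂`, so the largest of the three is at least `P`. The three
  -- alternatives below correspond to `J`, `J₁` and `J₂` being the largest.
  rcases le_total J J₁ with h01 | h01 <;> rcases le_total J J₂ with h02 | h02 <;>
    rcases le_total J₁ J₂ with h12 | h12
  all_goals
    first
    | (have hdom : P ≤ J := by linarith
       have h1 : M ≤ 64 * A * P ^ (1 - ε) := sq_mul_min_rpow_le_output hρ hε hε' h hx.le hy.le
       have h2 := rpow_mul_neg_rpow_le_one hP (by linarith) hdom (show 0 ≤ 1 - ε by linarith)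
       calc _ ≤ 64 * A * P ^ (1 - ε) * (J ^ (-(1 - ε)) * J₁ ^ (-(1 + ε)) * J₂ ^ (-(1 + ε))) := by
              gcongr
         _ = 64 * (A * (J₁ ^ (-(1 + ε)) * J₂ ^ (-(1 + ε)))) *
              (P ^ (1 - ε) * J ^ (-(1 - ε))) := by ring
         _ ≤ 64 * (A * (J₁ ^ (-(1 + ε)) * J₂ ^ (-(1 + ε)))) * 1 := by gcongr
         _ ≤ _ := by linarith)
    | (have hdom : P ≤ J₁ := by linarith
       have h1 : M ≤ 64 * B * P ^ (1 - ε) := sq_mul_min_rpow_le_input hρ hε hε' h hx.le hy.le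
       have h2 := rpow_mul_neg_rpow_le_one hP (by linarith) hdom (show 0 ≤ 1 - ε by linarith)
       have h3 := neg_rpow_mul_neg_rpow_le (by linarith) h01 hε
       calc _ ≤ 64 * B * P ^ (1 - ε) * (J ^ (-(1 + ε)) * J₁ ^ (-(1 - ε)) * J₂ ^ (-(1 + ε))) := by
              gcongr
         _ = 64 * (B * (J ^ (-(1 + ε)) * J₂ ^ (-(1 + ε)))) *
              (P ^ (1 - ε) * J₁ ^ (-(1 - ε))) := by ring
         _ ≤ 64 * (B * (J ^ (-(1 + ε)) * J₂ ^ (-(1 + ε)))) * 1 := by gcongr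
         _ ≤ _ := by linarith)
    | (have hdom : P ≤ J₂ := by linarith
       have h1 : M ≤ 64 * C * P ^ (1 - ε) := by
         have := sq_mul_min_rpow_le_input hρ hε hε' h hy.le hx.le
         rwa [add_comm y x, min_comm, mul_right_comm |x + y|] at this
       have h2 := rpow_mul_neg_rpow_le_one hP (by linarith) hdom (show 0 ≤ 1 - ε by linarith)
       have h3 := neg_rpow_mul_neg_rpow_le (by linarith) h02 hε
       calc _ = M * (J ^ (-(1 - ε)) * J₂ ^ (-(1 + ε)) * J₁ ^ (-(1 + ε))) := by ring
         _ ≤ 64 * C * P ^ (1 - ε) * (J ^ (-(1 + ε)) * J₂ ^ (-(1 - ε)) * J₁ ^ (-(1 + ε))) := by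
              gcongr
         _ = 64 * (C * (J ^ (-(1 + ε)) * J₁ ^ (-(1 + ε)))) *
              (P ^ (1 - ε) * J₂ ^ (-(1 - ε))) := by ring
         _ ≤ 64 * (C * (J ^ (-(1 + ε)) * J₁ ^ (-(1 + ε)))) * 1 := by gcongr
         _ ≤ _ := by linarith)

/-- The multiplier without derivative is controlled by the output variables alone. -/
lemma min_rpow_mul_le {x y s s₁ s₂ ρ b : ℝ} (hρ : 0 ≤ ρ) (hb : ρ / 2 ≤ b) (hxy : x + y ≠ 0)
    (hs : s - s₁ - s₂ = -(3 * ((x + y) * x * y))) :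
    (min |x| |y|) ^ ρ ≤
      |x + y| ^ (-(ρ / 2)) * (1 + |s|) ^ (ρ / 2) * ((1 + |s₁|) ^ b * (1 + |s₂|) ^ b) := by
  have hJ : 1 ≤ 1 + |s| := by linarith [abs_nonneg s]
  have hJ1 : 1 ≤ 1 + |s₁| := by linarith [abs_nonneg s₁]
  have hJ2 : 1 ≤ 1 + |s₂| := by linarith [abs_nonneg s₂]
  have hres : 3 * (|x + y| * |x| * |y|) ≤ |s| + |s₁| + |s₂| := by
    calc 3 * (|x + y| * |x| * |y|) = |s - s₁ - s₂| := by
          rw [hs, abs_neg, abs_mul, abs_mul, abs_mul]; norm_num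
      _ ≤ |s - s₁| + |s₂| := abs_sub _ _
      _ ≤ _ := by gcongr; exact abs_sub _ _
  have h0 : 0 < |x + y| := abs_pos.2 hxy
  -- Each modulation is at most the product of the three brackets, so their sum is at most three
  -- times it.
  have hprod : |x + y| * (|x| * |y|) ≤ (1 + |s|) * ((1 + |s₁|) * (1 + |s₂|)) := by
    nlinarith [abs_nonneg s, abs_nonneg s₁, abs_nonneg s₂, mul_nonneg (abs_nonneg s) (abs_nonneg s₁),
      mul_nonneg (abs_nonneg s) (abs_nonneg s₂), mul_nonneg (abs_nonneg s₁) (abs_nonneg s₂),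
      mul_nonneg (abs_nonneg s) (mul_nonneg (abs_nonneg s₁) (abs_nonneg s₂)),
      mul_nonneg (abs_nonneg (x + y)) (mul_nonneg (abs_nonneg x) (abs_nonneg y))]
  have hm : (min |x| |y|) ^ ρ ≤ (|x| * |y|) ^ (ρ / 2) := by
    calc (min |x| |y|) ^ ρ = ((min |x| |y|) ^ 2) ^ (ρ / 2) := by
          rw [← Real.rpow_natCast, ← Real.rpow_mul (by positivity)]; congr 1; push_cast; ring
      _ ≤ _ := by
          gcongr
          rw [sq]
          exact mul_le_mul (min_le_left _ _) (min_le_right _ _) (by positivity) (by positivity)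
  have h1 : |x| * |y| ≤ |x + y|⁻¹ * ((1 + |s|) * ((1 + |s₁|) * (1 + |s₂|))) := by
    rw [← div_eq_inv_mul, le_div_iff₀ h0]; linarith
  calc (min |x| |y|) ^ ρ ≤ (|x| * |y|) ^ (ρ / 2) := hm
    _ ≤ (|x + y|⁻¹ * ((1 + |s|) * ((1 + |s₁|) * (1 + |s₂|)))) ^ (ρ / 2) := by gcongr
    _ = |x + y| ^ (-(ρ / 2)) * (1 + |s|) ^ (ρ / 2) *
          ((1 + |s₁|) ^ (ρ / 2) * (1 + |s₂|) ^ (ρ / 2)) := by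
        rw [Real.mul_rpow (by positivity) (by positivity),
          Real.mul_rpow (by positivity) (by positivity),
          Real.mul_rpow (by positivity) (by positivity), Real.inv_rpow h0.le,
          Real.rpow_neg h0.le]
        ring
    _ ≤ _ := by gcongr

/-! ### One-dimensional integrals of decaying weights. -/

noncomputable section

/-- The weight `(1 + |x|)^(-γ)` with values in `ℝ≥0∞`. -/
def bracketDecay (γ x : ℝ) : ℝ≥0∞ := ENNReal.ofReal ((1 + |x|) ^ (-γ))

lemma bracketDecay_neg (γ x : ℝ) : bracketDecay γ (-x) = bracketDecay γ x := by
  simp [bracketDecay]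

@[fun_prop]
lemma measurable_bracketDecay (γ : ℝ) : Measurable (bracketDecay γ) := by
  unfold bracketDecay; fun_prop

lemma bracketDecay_le_one {γ : ℝ} (hγ : 0 ≤ γ) (x : ℝ) : bracketDecay γ x ≤ 1 := by
  rw [bracketDecay, ENNReal.ofReal_le_one]
  exact Real.rpow_le_one_of_one_le_of_nonpos (by linarith [abs_nonneg x]) (by linarith)

lemma lintegral_bracketDecay_lt_top {γ : ℝ} (hγ : 1 < γ) : ∫⁻ x, bracketDecay γ x < ∞ := by
  have := finite_integral_one_add_norm (E := ℝ) (μ := volume) (r := γ) (by simpa using hγ)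
  simpa [bracketDecay, Real.norm_eq_abs] using this

/-- The larger of `|x|` and `|y|` is at least `|x - y| / 2`, so its weight is controlled by that of
`x - y`. -/
lemma bracketDecay_mul_le {γ : ℝ} (hγ : 0 ≤ γ) (x y : ℝ) :
    bracketDecay γ x * bracketDecay γ y ≤
      ENNReal.ofReal (2 ^ γ) * bracketDecay γ (x - y) *
        (bracketDecay γ x + bracketDecay γ y) := by
  have key : ∀ x y : ℝ, |y| ≤ |x| →
      bracketDecay γ x ≤ ENNReal.ofReal (2 ^ γ) * bracketDecay γ (x - y) := by
    intro x y hxy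
    rw [bracketDecay, bracketDecay, ← ENNReal.ofReal_mul (by positivity)]
    apply ENNReal.ofReal_le_ofReal
    have h : 1 + |x - y| ≤ 2 * (1 + |x|) := by linarith [abs_sub x y]
    have h2 : (1 + |x - y|) ^ γ ≤ 2 ^ γ * (1 + |x|) ^ γ := by
      rw [← Real.mul_rpow (by norm_num) (by positivity)]
      gcongr
    rw [Real.rpow_neg (by positivity), Real.rpow_neg (by positivity), ← div_eq_mul_inv,
      inv_eq_one_div, div_le_div_iff₀ (by positivity) (by positivity)]
    linarith
  rcases le_total |y| |x| with h | h
  · calc _ ≤ ENNReal.ofReal (2 ^ γ) * bracketDecay γ (x - y) * bracketDecay γ y := by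
          gcongr; exact key x y h
      _ ≤ _ := by gcongr; exact le_add_self
  · have := key y x h
    rw [← neg_sub, bracketDecay_neg] at this
    calc _ = bracketDecay γ y * bracketDecay γ x := mul_comm _ _
      _ ≤ ENNReal.ofReal (2 ^ γ) * bracketDecay γ (x - y) * bracketDecay γ x := by gcongr
      _ ≤ _ := by gcongr; exact le_self_add

lemma lintegral_bracketDecay_mul_le {γ : ℝ} (hγ : 0 ≤ γ) (a b : ℝ) :
    ∫⁻ t, bracketDecay γ (t - a) * bracketDecay γ (t - b) ≤
      ENNReal.ofReal (2 ^ γ) * (2 * ∫⁻ x, bracketDecay γ x) * bracketDecay γ (a - b) := by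
  calc ∫⁻ t, bracketDecay γ (t - a) * bracketDecay γ (t - b)
      ≤ ∫⁻ t, ENNReal.ofReal (2 ^ γ) * bracketDecay γ (a - b) *
        (bracketDecay γ (t - a) + bracketDecay γ (t - b)) := by
        refine lintegral_mono fun t => ?_
        refine (bracketDecay_mul_le hγ _ _).trans_eq ?_
        rw [sub_sub_sub_cancel_left, ← neg_sub a b, bracketDecay_neg]
    _ = _ := by
        rw [lintegral_const_mul _ (by fun_prop), lintegral_add_left (by fun_prop),
          lintegral_sub_right_eq_self (bracketDecay γ), lintegral_sub_right_eq_self (bracketDecay γ)]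
        ring

/-- Change of variables along the quadratic. It takes equal values at distinct points only if they
are symmetric about `d / 2`, which `hinj` excludes. -/
lemma setLIntegral_quadratic_le {γ c d a : ℝ} (hc : c ≠ 0) {s : Set ℝ} (hs : MeasurableSet s)
    (hinj : ∀ x ∈ s, ∀ y ∈ s, x + y ≠ d) :
    ∫⁻ x in s, ENNReal.ofReal |3 * c * (2 * x - d)| *
        bracketDecay γ (a + 3 * c * (x * (x - d))) ≤ ∫⁻ x, bracketDecay γ x := by
  rw [← lintegral_image_eq_lintegral_abs_deriv_mul (f := fun x => a + 3 * c * (x * (x - d)))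
    (f' := fun x => 3 * c * (2 * x - d)) hs]
  · exact setLIntegral_le_lintegral _ _
  · intro x _
    have h : HasDerivAt (fun x : ℝ => a + 3 * c * (x * (x - d)))
        (3 * c * (1 * (x - d) + x * 1)) x :=
      (((hasDerivAt_id x).mul ((hasDerivAt_id x).sub_const d)).const_mul (3 * c)).const_add a
    exact (h.congr_deriv (by ring)).hasDerivWithinAt
  · intro x hx y hy hxy
    have h1 : (x - y) * (x + y - d) = 0 := by
      have : 3 * c * ((x - y) * (x + y - d)) = 0 := by
        have : a + 3 * c * (x * (x - d)) = a + 3 * c * (y * (y - d)) := hxy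
        linarith
      simpa [hc] using this
    rcases mul_eq_zero.1 h1 with h | h
    · linarith
    · exact absurd (by linarith) (hinj x hx y hy)

/-- The key one-dimensional estimate: a decaying function of a quadratic polynomial, integrated
against its derivative and the square root of its leading coefficient. -/
lemma lintegral_quadratic_le {γ : ℝ} (hγ : 0 ≤ γ) (c d a : ℝ) :
    ∫⁻ x, ENNReal.ofReal (|c| * |2 * x - d| + √|c|) *
        bracketDecay γ (a + 3 * c * (x * (x - d))) ≤ 2 + 4 * ∫⁻ x, bracketDecay γ x := by
  rcases eq_or_ne c 0 with rfl | hc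
  · simp
  have hr : 0 < √|c| := Real.sqrt_pos.2 (abs_pos.2 hc)
  have hr2 : |c| = √|c| * √|c| := (Real.mul_self_sqrt (abs_nonneg c)).symm
  set r := √|c| with hrdef
  -- An interval of length `1 / r` around the vertex. Inside, the prefactor is at most `2r`,
  -- contributing `2`; outside, `r ≤ |c||2x - d|` and the derivative term dominates.
  set I : Set ℝ := Set.Icc (d / 2 - 1 / (2 * r)) (d / 2 + 1 / (2 * r)) with hI
  set G : ℝ → ℝ≥0∞ := fun x => ENNReal.ofReal |3 * c * (2 * x - d)| *
        bracketDecay γ (a + 3 * c * (x * (x - d))) with hG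
  have hGm : Measurable G := by
    have : Measurable fun x : ℝ => bracketDecay γ (a + 3 * c * (x * (x - d))) :=
      (measurable_bracketDecay γ).comp (by fun_prop)
    exact Measurable.mul (by fun_prop) this
  have hpt : ∀ x, ENNReal.ofReal (|c| * |2 * x - d| + r) *
        bracketDecay γ (a + 3 * c * (x * (x - d))) ≤
      I.indicator (fun _ => ENNReal.ofReal (2 * r)) x + 2 * G x := by
    intro x
    by_cases hx : x ∈ I
    · rw [Set.indicator_of_mem hx]
      refine le_add_right ?_
      calc _ ≤ ENNReal.ofReal (|c| * |2 * x - d| + r) * 1 := by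
            gcongr; exact bracketDecay_le_one hγ _
        _ ≤ _ := by
          rw [mul_one]
          apply ENNReal.ofReal_le_ofReal
          have : |2 * x - d| ≤ 1 / r := by
            have e : 1 / r = 2 * (1 / (2 * r)) := by field_simp
            rw [e, abs_le]
            constructor <;> linarith [hx.1, hx.2]
          have h2 : r * |2 * x - d| ≤ 1 := by
            rw [le_div_iff₀ hr] at this; linarith
          rw [hr2]
          nlinarith
    · refine le_add_left ?_
      simp only [hG]
      rw [← mul_assoc (2 : ℝ≥0∞)]
      gcongr ?_ * _
      rw [show (2 : ℝ≥0∞) = ENNReal.ofReal 2 by simp, ← ENNReal.ofReal_mul (by norm_num)]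
      apply ENNReal.ofReal_le_ofReal
      have : 1 / r ≤ |2 * x - d| := by
        have e : 1 / r = 2 * (1 / (2 * r)) := by field_simp
        by_contra hcon
        push Not at hcon
        rw [e, abs_lt] at hcon
        exact hx ⟨by linarith [hcon.1], by linarith [hcon.2]⟩
      have h2 : 1 ≤ r * |2 * x - d| := by
        rw [div_le_iff₀ hr] at this; linarith
      rw [abs_mul, abs_mul, abs_of_pos (show (0 : ℝ) < 3 by norm_num)]
      have : r ≤ |c| * |2 * x - d| := by rw [hr2]; nlinarith
      nlinarith
  have hG1 : ∫⁻ x, G x ≤ 2 * ∫⁻ x, bracketDecay γ x := by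
    have h1 : ∫⁻ x in Set.Iio (d / 2), G x ≤ ∫⁻ x, bracketDecay γ x :=
      setLIntegral_quadratic_le hc measurableSet_Iio fun x hx y hy => by
        have := Set.mem_Iio.1 hx; have := Set.mem_Iio.1 hy; linarith
    have h2 : ∫⁻ x in (Set.Iio (d / 2))ᶜ, G x ≤ ∫⁻ x, bracketDecay γ x := by
      rw [Set.compl_Iio, ← setLIntegral_congr Ioi_ae_eq_Ici]
      exact setLIntegral_quadratic_le hc measurableSet_Ioi fun x hx y hy => by
        have := Set.mem_Ioi.1 hx; have := Set.mem_Ioi.1 hy; linarith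
    rw [← lintegral_add_compl G measurableSet_Iio (A := Set.Iio (d / 2)), two_mul]
    exact add_le_add h1 h2
  calc _ ≤ ∫⁻ x, (I.indicator (fun _ => ENNReal.ofReal (2 * r)) x + 2 * G x) :=
        lintegral_mono hpt
    _ = 2 + 2 * ∫⁻ x, G x := by
        rw [lintegral_add_right _ (hGm.const_mul 2), lintegral_const_mul _ hGm,
          lintegral_indicator measurableSet_Icc, setLIntegral_const, Real.volume_Icc,
          ← ENNReal.ofReal_mul (by positivity)]
        congr 1
        rw [show (2 : ℝ≥0∞) = ENNReal.ofReal 2 by simp]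
        congr 1
        field_simp
        ring
    _ ≤ 2 + 2 * (2 * ∫⁻ x, bracketDecay γ x) := by gcongr
    _ = _ := by ring

/-! ### Cauchy–Schwarz and `L²` bounds for bilinear operators with a kernel. -/

lemma ENNReal.sq_rpow_half (x : ℝ≥0∞) : (x ^ (1 / 2 : ℝ)) ^ 2 = x := by
  rw [← ENNReal.rpow_natCast, ← ENNReal.rpow_mul]; norm_num

lemma sq_lintegral_mul_le {α : Type*} [MeasurableSpace α] {μ : Measure α} {f g : α → ℝ≥0∞}
    (hf : AEMeasurable f μ) (hg : AEMeasurable g μ) :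
    (∫⁻ a, f a * g a ∂μ) ^ 2 ≤ (∫⁻ a, f a ^ 2 ∂μ) * ∫⁻ a, g a ^ 2 ∂μ := by
  have h := ENNReal.lintegral_mul_le_Lp_mul_Lq μ Real.HolderConjugate.two_two hf hg
  calc (∫⁻ a, f a * g a ∂μ) ^ 2
      ≤ ((∫⁻ a, f a ^ (2 : ℝ) ∂μ) ^ (1 / 2 : ℝ) * (∫⁻ a, g a ^ (2 : ℝ) ∂μ) ^ (1 / 2 : ℝ)) ^ 2 := by
        gcongr; exact h
    _ = _ := by rw [mul_pow, ENNReal.sq_rpow_half, ENNReal.sq_rpow_half]; simp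

lemma ENNReal.le_rpow_half_of_sq_le {x y : ℝ≥0∞} (h : x ^ 2 ≤ y) : x ≤ y ^ (1 / 2 : ℝ) := by
  calc x = (x ^ 2) ^ (1 / 2 : ℝ) := by
        rw [← ENNReal.rpow_natCast, ← ENNReal.rpow_mul]; norm_num
    _ ≤ _ := by gcongr

lemma ENNReal.add_add_sq_le (a b c : ℝ≥0∞) : (a + b + c) ^ 2 ≤ 9 * (a ^ 2 + b ^ 2 + c ^ 2) := by
  have key : ∀ m : ℝ≥0∞, a ≤ m → b ≤ m → c ≤ m → (a + b + c) ^ 2 ≤ 9 * m ^ 2 := by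
    intro m ha hb hc
    calc (a + b + c) ^ 2 ≤ (m + m + m) ^ 2 := by gcongr
      _ = 9 * m ^ 2 := by ring
  refine (key (max a (max b c)) (le_max_left _ _) (le_max_of_le_right (le_max_left _ _))
    (le_max_of_le_right (le_max_right _ _))).trans ?_
  gcongr
  rcases max_choice a (max b c) with h | h
  · rw [h, add_assoc]; exact le_self_add
  · rcases max_choice b c with h' | h'
    · rw [h, h']; exact le_add_self.trans le_self_add
    · rw [h, h']; exact le_add_self

section Schur

variable {G : Type*} [AddCommGroup G] [MeasurableSpace G] [MeasurableAdd₂ G] [MeasurableNeg G]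
  {μ : Measure G} [SFinite μ] [μ.IsAddLeftInvariant]

/-- Cauchy–Schwarz in `q` separates `K` from `F` and `H`; Tonelli and translation invariance do the
rest. -/
lemma lintegral_sq_bilinear_le_of_output {K : G → G → ℝ≥0∞} {F H : G → ℝ≥0∞} {C : ℝ≥0∞}
    (hK : Measurable (Function.uncurry K)) (hF : Measurable F) (hH : Measurable H)
    (hC : ∀ p, ∫⁻ q, K p q ∂μ ≤ C) :
    ∫⁻ p, (∫⁻ q, K p q ^ (1 / 2 : ℝ) * (F (p - q) * H q) ∂μ) ^ 2 ∂μ ≤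
      C * ((∫⁻ p, F p ^ 2 ∂μ) * ∫⁻ q, H q ^ 2 ∂μ) := by
  calc _ ≤ ∫⁻ p, C * ∫⁻ q, (F (p - q) * H q) ^ 2 ∂μ ∂μ := by
        refine lintegral_mono fun p => ?_
        have hKp : Measurable (K p) := hK.comp measurable_prodMk_left
        refine (sq_lintegral_mul_le (by fun_prop) (by fun_prop)).trans ?_
        gcongr
        simpa only [ENNReal.sq_rpow_half] using hC p
    _ = C * ∫⁻ p, ∫⁻ q, (F (p - q) * H q) ^ 2 ∂μ ∂μ := by
        refine lintegral_const_mul _ (Measurable.lintegral_prod_right' (f := fun z : G × G =>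
          (F (z.1 - z.2) * H z.2) ^ 2) (by fun_prop))
    _ = C * ∫⁻ q, ∫⁻ p, F (p - q) ^ 2 * H q ^ 2 ∂μ ∂μ := by
        rw [lintegral_lintegral_swap]
        · simp only [mul_pow]
        · exact Measurable.aemeasurable (by fun_prop)
    _ = _ := by
        congr 1
        rw [← lintegral_const_mul _ (by fun_prop)]
        refine lintegral_congr fun q => ?_
        rw [lintegral_mul_const _ (by fun_prop), lintegral_sub_right_eq_self (fun p => F p ^ 2)]

variable [μ.IsNegInvariant]

/-- Cauchy–Schwarz now keeps `K` together with `H`: the integral of `F²` splits off, and Tonelli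
lets `K` be integrated in `p` first. -/
lemma lintegral_sq_bilinear_le_of_right {K : G → G → ℝ≥0∞} {F H : G → ℝ≥0∞} {C : ℝ≥0∞}
    (hK : Measurable (Function.uncurry K)) (hF : Measurable F) (hH : Measurable H)
    (hC : ∀ q, ∫⁻ p, K p q ∂μ ≤ C) :
    ∫⁻ p, (∫⁻ q, K p q ^ (1 / 2 : ℝ) * (F (p - q) * H q) ∂μ) ^ 2 ∂μ ≤
      C * ((∫⁻ p, F p ^ 2 ∂μ) * ∫⁻ q, H q ^ 2 ∂μ) := by
  have hKH : Measurable fun z : G × G => K z.1 z.2 * H z.2 ^ 2 :=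
    Measurable.mul hK (by fun_prop)
  calc _ ≤ ∫⁻ p, (∫⁻ r, F r ^ 2 ∂μ) * ∫⁻ q, K p q * H q ^ 2 ∂μ ∂μ := by
        refine lintegral_mono fun p => ?_
        have hKp : Measurable (K p) := hK.comp measurable_prodMk_left
        have h := sq_lintegral_mul_le (μ := μ) (f := fun q => F (p - q))
          (g := fun q => K p q ^ (1 / 2 : ℝ) * H q) (by fun_prop) (by fun_prop)
        simp only [mul_pow, ENNReal.sq_rpow_half] at h
        rw [lintegral_sub_left_eq_self (fun q => F q ^ 2)] at h
        refine le_trans (le_of_eq ?_) h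
        congr 1
        refine lintegral_congr fun q => ?_
        ring
    _ = (∫⁻ r, F r ^ 2 ∂μ) * ∫⁻ p, ∫⁻ q, K p q * H q ^ 2 ∂μ ∂μ :=
        lintegral_const_mul _ (Measurable.lintegral_prod_right' hKH)
    _ = (∫⁻ r, F r ^ 2 ∂μ) * ∫⁻ q, ∫⁻ p, K p q * H q ^ 2 ∂μ ∂μ := by
        rw [lintegral_lintegral_swap hKH.aemeasurable]
    _ ≤ (∫⁻ r, F r ^ 2 ∂μ) * ∫⁻ q, C * H q ^ 2 ∂μ := by
        gcongr with q
        have hKq : Measurable fun p => K p q := hK.comp measurable_prodMk_right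
        rw [lintegral_mul_const _ hKq]
        gcongr
        exact hC q
    _ = _ := by rw [lintegral_const_mul _ (by fun_prop)]; ring

/-- The substitution `q ↦ p - q` exchanges the roles of `F` and `H`. -/
lemma lintegral_sq_bilinear_le_of_left {K : G → G → ℝ≥0∞} {F H : G → ℝ≥0∞} {C : ℝ≥0∞}
    (hK : Measurable (Function.uncurry K)) (hF : Measurable F) (hH : Measurable H)
    (hC : ∀ q, ∫⁻ p, K p (p - q) ∂μ ≤ C) :
    ∫⁻ p, (∫⁻ q, K p q ^ (1 / 2 : ℝ) * (F (p - q) * H q) ∂μ) ^ 2 ∂μ ≤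
      C * ((∫⁻ p, F p ^ 2 ∂μ) * ∫⁻ q, H q ^ 2 ∂μ) := by
  have hK' : Measurable (Function.uncurry fun p q => K p (p - q)) :=
    hK.comp (f := fun z : G × G => (z.1, z.1 - z.2)) (by fun_prop)
  have h := lintegral_sq_bilinear_le_of_right hK' hH hF hC
  rw [mul_comm (∫⁻ p, F p ^ 2 ∂μ)]
  refine le_trans (le_of_eq ?_) h
  refine lintegral_congr fun p => ?_
  rw [← lintegral_sub_left_eq_self _ p]
  congr 1
  refine lintegral_congr fun q => ?_
  rw [sub_sub_cancel, mul_comm (F q)]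

/-- A bilinear operator is bounded on `L²` if its squared kernel is dominated by three kernels,
each of which is integrable uniformly in one of the three variables `p`, `q`, `p - q`. -/
lemma lintegral_sq_bilinear_le {κ KA KB KC : G → G → ℝ≥0∞} {F H : G → ℝ≥0∞} {C : ℝ≥0∞}
    (hκ : ∀ p q, κ p q ^ 2 ≤ KA p q + KB p q + KC p q)
    (hKA : Measurable (Function.uncurry KA)) (hKB : Measurable (Function.uncurry KB))
    (hKC : Measurable (Function.uncurry KC))
    (hF : AEMeasurable F μ) (hH : AEMeasurable H μ)
    (hA : ∀ p, ∫⁻ q, KA p q ∂μ ≤ C) (hB : ∀ q, ∫⁻ p, KB p (p - q) ∂μ ≤ C)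
    (hC : ∀ q, ∫⁻ p, KC p q ∂μ ≤ C) :
    ∫⁻ p, (∫⁻ q, κ p q * (F (p - q) * H q) ∂μ) ^ 2 ∂μ ≤
      27 * C * ((∫⁻ p, F p ^ 2 ∂μ) * ∫⁻ q, H q ^ 2 ∂μ) := by
  wlog hm : Measurable F ∧ Measurable H generalizing F H
  · have h := this hF.measurable_mk.aemeasurable hH.measurable_mk.aemeasurable
      ⟨hF.measurable_mk, hH.measurable_mk⟩
    have hF2 : ∫⁻ p, F p ^ 2 ∂μ = ∫⁻ p, hF.mk F p ^ 2 ∂μ :=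
      lintegral_congr_ae (hF.ae_eq_mk.mono fun p hp => by simp only [hp])
    have hH2 : ∫⁻ p, H p ^ 2 ∂μ = ∫⁻ p, hH.mk H p ^ 2 ∂μ :=
      lintegral_congr_ae (hH.ae_eq_mk.mono fun p hp => by simp only [hp])
    rw [hF2, hH2]
    refine le_trans (le_of_eq ?_) h
    refine lintegral_congr fun p => ?_
    congr 1
    refine lintegral_congr_ae ?_
    have hp : ∀ᵐ q ∂μ, F (p - q) = hF.mk F (p - q) :=
      (Measure.measurePreserving_sub_left μ p).quasiMeasurePreserving.ae hF.ae_eq_mk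
    filter_upwards [hp, hH.ae_eq_mk] with q h1 h2
    rw [h1, h2]
  obtain ⟨hF', hH'⟩ := hm
  have hpt : ∀ p q, κ p q ≤
      KA p q ^ (1 / 2 : ℝ) + KB p q ^ (1 / 2 : ℝ) + KC p q ^ (1 / 2 : ℝ) := by
    intro p q
    refine (ENNReal.le_rpow_half_of_sq_le (hκ p q)).trans ?_
    refine (ENNReal.rpow_add_le_add_rpow _ _ (by norm_num) (by norm_num)).trans ?_
    gcongr
    exact ENNReal.rpow_add_le_add_rpow _ _ (by norm_num) (by norm_num)
  have hmeas : ∀ {K : G → G → ℝ≥0∞}, Measurable (Function.uncurry K) →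
      Measurable fun z : G × G => K z.1 z.2 ^ (1 / 2 : ℝ) * (F (z.1 - z.2) * H z.2) :=
    fun hK => Measurable.mul (Measurable.pow_const hK _) (by fun_prop)
  have hmeas₁ : ∀ {K : G → G → ℝ≥0∞}, Measurable (Function.uncurry K) → ∀ p,
      Measurable fun q => K p q ^ (1 / 2 : ℝ) * (F (p - q) * H q) :=
    fun hK _ => (hmeas hK).comp measurable_prodMk_left
  have hmeas' : ∀ {K : G → G → ℝ≥0∞}, Measurable (Function.uncurry K) →
      Measurable fun p => (∫⁻ q, K p q ^ (1 / 2 : ℝ) * (F (p - q) * H q) ∂μ) ^ 2 :=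
    fun hK => (Measurable.lintegral_prod_right' (hmeas hK)).pow_const 2
  calc _ ≤ ∫⁻ p, 9 * ((∫⁻ q, KA p q ^ (1 / 2 : ℝ) * (F (p - q) * H q) ∂μ) ^ 2 +
        (∫⁻ q, KB p q ^ (1 / 2 : ℝ) * (F (p - q) * H q) ∂μ) ^ 2 +
        (∫⁻ q, KC p q ^ (1 / 2 : ℝ) * (F (p - q) * H q) ∂μ) ^ 2) ∂μ := by
        refine lintegral_mono fun p => ?_
        refine le_trans ?_ (ENNReal.add_add_sq_le _ _ _)
        rw [← lintegral_add_left (hmeas₁ hKA p),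
          ← lintegral_add_right _ (hmeas₁ hKC p)]
        gcongr with q
        rw [← add_mul, ← add_mul]
        gcongr
        exact hpt p q
    _ = 9 * (∫⁻ p, (∫⁻ q, KA p q ^ (1 / 2 : ℝ) * (F (p - q) * H q) ∂μ) ^ 2 ∂μ +
        ∫⁻ p, (∫⁻ q, KB p q ^ (1 / 2 : ℝ) * (F (p - q) * H q) ∂μ) ^ 2 ∂μ +
        ∫⁻ p, (∫⁻ q, KC p q ^ (1 / 2 : ℝ) * (F (p - q) * H q) ∂μ) ^ 2 ∂μ) := by
        rw [lintegral_const_mul' _ _ (by norm_num),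
          lintegral_add_right _ (hmeas' hKC), lintegral_add_right _ (hmeas' hKB)]
    _ ≤ 9 * (C * ((∫⁻ p, F p ^ 2 ∂μ) * ∫⁻ q, H q ^ 2 ∂μ) +
        C * ((∫⁻ p, F p ^ 2 ∂μ) * ∫⁻ q, H q ^ 2 ∂μ) +
        C * ((∫⁻ p, F p ^ 2 ∂μ) * ∫⁻ q, H q ^ 2 ∂μ)) := by
        gcongr
        · exact lintegral_sq_bilinear_le_of_output hKA hF' hH' hA
        · exact lintegral_sq_bilinear_le_of_left hKB hF' hH' hB
        · exact lintegral_sq_bilinear_le_of_right hKC hF' hH' hC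
    _ = _ := by ring

end Schur

/-! ### Kernels in the modulations and the weighted bilinear estimate. -/

/-- The modulation `τ - ξ³` at the point `p = (ξ, τ)`. -/
def modulation (p : ℝ × ℝ) : ℝ := p.2 - p.1 ^ 3

@[fun_prop]
lemma measurable_modulation : Measurable modulation := by unfold modulation; fun_prop

lemma modulation_resonance (p q : ℝ × ℝ) :
    modulation p - modulation (p - q) - modulation q =
      -(3 * (((p - q).1 + q.1) * (p - q).1 * q.1)) := by
  simp only [modulation, Prod.fst_sub, Prod.snd_sub]; ring

/-- The kernel integrable in the input variable `q`. -/
def outputKernel (γ : ℝ) (p q : ℝ × ℝ) : ℝ≥0∞ :=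
  ENNReal.ofReal (|p.1| * |2 * q.1 - p.1| + √|p.1|) *
    (bracketDecay γ (modulation q) * bracketDecay γ (modulation (p - q)))

/-- The kernel integrable in the output variable `p`. -/
def inputKernel (γ : ℝ) (p q : ℝ × ℝ) : ℝ≥0∞ :=
  ENNReal.ofReal (|q.1| * |2 * p.1 - q.1| + √|q.1|) *
    (bracketDecay γ (modulation p) * bracketDecay γ (modulation (p - q)))

/-- A bound for the integrals of the kernels. -/
def kernelBound (γ : ℝ) : ℝ≥0∞ :=
  ENNReal.ofReal (2 ^ γ) * (2 * ∫⁻ x, bracketDecay γ x) * (2 + 4 * ∫⁻ x, bracketDecay γ x)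

lemma kernelBound_ne_top {γ : ℝ} (hγ : 1 < γ) : kernelBound γ ≠ ∞ := by
  have := (lintegral_bracketDecay_lt_top hγ).ne
  unfold kernelBound
  finiteness

lemma measurable_outputKernel (γ : ℝ) : Measurable (Function.uncurry (outputKernel γ)) := by
  unfold outputKernel Function.uncurry
  fun_prop

lemma measurable_inputKernel (γ : ℝ) : Measurable (Function.uncurry (inputKernel γ)) := by
  unfold inputKernel Function.uncurry
  fun_prop

/-- The inner integral in `τ` leaves a weight of `α - β`. In the applications both are cubics whose
leading terms cancel, and the remaining quadratic has derivative `3c(2x - d)`. -/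
lemma lintegral_quadratic_kernel_le {γ : ℝ} (hγ : 0 ≤ γ) {α β : ℝ → ℝ} (hα : Measurable α)
    (hβ : Measurable β) {c d a : ℝ} (h : ∀ x, α x - β x = a + 3 * c * (x * (x - d))) :
    ∫⁻ q : ℝ × ℝ, ENNReal.ofReal (|c| * |2 * q.1 - d| + √|c|) *
      (bracketDecay γ (q.2 - α q.1) * bracketDecay γ (q.2 - β q.1)) ≤ kernelBound γ := by
  have hm : Measurable fun q : ℝ × ℝ => ENNReal.ofReal (|c| * |2 * q.1 - d| + √|c|) *
      (bracketDecay γ (q.2 - α q.1) * bracketDecay γ (q.2 - β q.1)) := by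
    fun_prop
  rw [Measure.volume_eq_prod, lintegral_prod _ hm.aemeasurable]
  calc _ ≤ ∫⁻ x, ENNReal.ofReal (2 ^ γ) * (2 * ∫⁻ x, bracketDecay γ x) *
        (ENNReal.ofReal (|c| * |2 * x - d| + √|c|) *
          bracketDecay γ (a + 3 * c * (x * (x - d)))) := by
        refine lintegral_mono fun x => ?_
        dsimp only
        rw [lintegral_const_mul _ (by fun_prop), ← h, mul_left_comm]
        gcongr
        exact lintegral_bracketDecay_mul_le hγ _ _
    _ ≤ _ := by
        rw [lintegral_const_mul _ (by fun_prop), kernelBound]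
        gcongr
        exact lintegral_quadratic_le hγ c d a

lemma lintegral_outputKernel_le {γ : ℝ} (hγ : 0 ≤ γ) (p : ℝ × ℝ) :
    ∫⁻ q, outputKernel γ p q ≤ kernelBound γ := by
  refine le_trans (le_of_eq ?_) (lintegral_quadratic_kernel_le hγ (α := fun x => x ^ 3)
    (β := fun x => p.2 - (p.1 - x) ^ 3) (c := p.1) (d := p.1) (a := -modulation p)
    (by fun_prop) (by fun_prop) fun x => ?_)
  · refine lintegral_congr fun q => ?_
    rw [outputKernel, ← bracketDecay_neg γ (modulation (p - q))]
    congr 3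
    simp only [modulation, Prod.fst_sub, Prod.snd_sub]; ring
  · simp only [modulation]; ring

lemma lintegral_inputKernel_le {γ : ℝ} (hγ : 0 ≤ γ) (q : ℝ × ℝ) :
    ∫⁻ p, inputKernel γ p q ≤ kernelBound γ := by
  refine le_trans (le_of_eq ?_) (lintegral_quadratic_kernel_le hγ (α := fun x => x ^ 3)
    (β := fun x => q.2 + (x - q.1) ^ 3) (c := q.1) (d := q.1) (a := -modulation q)
    (by fun_prop) (by fun_prop) fun x => ?_)
  · refine lintegral_congr fun p => ?_
    rw [inputKernel]
    congr 3
    simp only [modulation, Prod.fst_sub, Prod.snd_sub]; ring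
  · simp only [modulation]; ring

/-- The multiplier of `(u, v) ↦ ∂ₓ B_ρ(u, v)` with the weights of the three norms included. -/
def weightedMultiplier (ρ b : ℝ) (p q : ℝ × ℝ) : ℝ :=
  |p.1| * (1 + |modulation p|) ^ (b - 1) * (min |p.1 - q.1| |q.1|) ^ ρ *
    ((1 + |modulation (p - q)|) ^ (-b) * (1 + |modulation q|) ^ (-b))

lemma weightedMultiplier_nonneg (ρ b : ℝ) (p q : ℝ × ℝ) : 0 ≤ weightedMultiplier ρ b p q := by
  unfold weightedMultiplier; positivity

/-- For `b = (1 + ε)/2`, squaring turns the exponents `b - 1` and `-b` into `-(1 - ε)` and `-(1 +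
ε)`. The two input kernels are the same function, evaluated at `q` and at `p - q`. -/
lemma sq_weightedMultiplier_le {ρ ε : ℝ} (hρ : 0 ≤ ρ) (hε : 0 < ε) (hε' : ε ≤ 1 / 8)
    (h : 2 * ρ + 12 * ε ≤ 3 / 2) (p q : ℝ × ℝ) :
    ENNReal.ofReal (weightedMultiplier ρ ((1 + ε) / 2) p q) ^ 2 ≤
      64 * outputKernel (1 + ε) p q + 64 * inputKernel (1 + ε) p (p - q) +
        64 * inputKernel (1 + ε) p q := by
  have hsq : ∀ (a e : ℝ), (((1 + |a|) ^ e) ^ 2 : ℝ) = (1 + |a|) ^ (2 * e) := fun a e => by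
    rw [← Real.rpow_natCast, ← Real.rpow_mul (by positivity)]; congr 1; push_cast; ring
  have hsq' : ((min |p.1 - q.1| |q.1|) ^ ρ) ^ 2 = (min |p.1 - q.1| |q.1|) ^ (2 * ρ) := by
    rw [← Real.rpow_natCast, ← Real.rpow_mul (by positivity)]; congr 1; push_cast; ring
  have key := multiplier_sq_le hρ hε hε' h (modulation_resonance p q)
  have e1 : weightedMultiplier ρ ((1 + ε) / 2) p q ^ 2 =
      |(p - q).1 + q.1| ^ 2 * (min |(p - q).1| |q.1|) ^ (2 * ρ) *
        ((1 + |modulation p|) ^ (-(1 - ε)) * (1 + |modulation (p - q)|) ^ (-(1 + ε)) *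
          (1 + |modulation q|) ^ (-(1 + ε))) := by
    simp only [weightedMultiplier, mul_pow, hsq, hsq', Prod.fst_sub, sub_add_cancel]
    rw [show 2 * ((1 + ε) / 2 - 1) = -(1 - ε) by ring,
      show 2 * -((1 + ε) / 2) = -(1 + ε) by ring]
    ring
  rw [← e1] at key
  rw [← ENNReal.ofReal_pow (weightedMultiplier_nonneg _ _ _ _)]
  refine (ENNReal.ofReal_le_ofReal key).trans (le_of_eq ?_)
  rw [ENNReal.ofReal_mul (by norm_num), ENNReal.ofReal_add (by positivity) (by positivity),
    ENNReal.ofReal_add (by positivity) (by positivity)]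
  simp only [outputKernel, inputKernel, bracketDecay, mul_add]
  simp (disch := positivity) only [ENNReal.ofReal_mul, Prod.fst_sub, sub_sub_cancel,
    ENNReal.ofReal_ofNat]
  rw [show p.1 - q.1 + q.1 = p.1 by ring, show p.1 - q.1 - q.1 = -(2 * q.1 - p.1) by ring,
    show p.1 - q.1 + 2 * q.1 = 2 * p.1 - (p.1 - q.1) by ring,
    show q.1 + 2 * (p.1 - q.1) = 2 * p.1 - q.1 by ring, abs_neg,
    mul_comm (ENNReal.ofReal ((1 + |modulation (p - q)|) ^ (-(1 + ε)))) (ENNReal.ofReal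
      ((1 + |modulation q|) ^ (-(1 + ε))))]

/-- The weighted bilinear estimate in `L²`. -/
lemma lintegral_sq_weightedMultiplier_le {ρ ε : ℝ} (hρ : 0 ≤ ρ) (hε : 0 < ε) (hε' : ε ≤ 1 / 8)
    (h : 2 * ρ + 12 * ε ≤ 3 / 2) {F H : ℝ × ℝ → ℝ≥0∞} (hF : AEMeasurable F)
    (hH : AEMeasurable H) :
    ∫⁻ p, (∫⁻ q, ENNReal.ofReal (weightedMultiplier ρ ((1 + ε) / 2) p q) *
        (F (p - q) * H q)) ^ 2 ≤
      27 * (64 * kernelBound (1 + ε)) * ((∫⁻ p, F p ^ 2) * ∫⁻ q, H q ^ 2) := by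
  have hγ : 0 ≤ 1 + ε := by linarith
  refine lintegral_sq_bilinear_le (sq_weightedMultiplier_le hρ hε hε' h)
    ((measurable_outputKernel _).const_mul 64) ?_ ((measurable_inputKernel _).const_mul 64)
    hF hH (fun p => ?_) (fun q => ?_) fun q => ?_
  · exact ((measurable_inputKernel (1 + ε)).comp (f := fun z : (ℝ × ℝ) × (ℝ × ℝ) =>
      (z.1, z.1 - z.2)) (by fun_prop)).const_mul 64
  · rw [lintegral_const_mul' _ _ (by norm_num)]
    gcongr
    exact lintegral_outputKernel_le hγ p
  · simp only [sub_sub_cancel]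
    rw [lintegral_const_mul' _ _ (by norm_num)]
    gcongr
    exact lintegral_inputKernel_le hγ q
  · rw [lintegral_const_mul' _ _ (by norm_num)]
    gcongr
    exact lintegral_inputKernel_le hγ q

/-! ### Functions representing Fourier transforms of tempered distributions. -/

lemma quasiMeasurePreserving_smul_real {r : ℝ} (hr : r ≠ 0) :
    Measure.QuasiMeasurePreserving (fun p : ℝ × ℝ => r • p) volume volume := by
  refine ⟨by fun_prop, ?_⟩
  rw [Measure.map_addHaar_smul _ hr]
  exact Measure.smul_absolutelyContinuous

lemma two_pi_ne_zero : (2 * Real.pi : ℝ) ≠ 0 := by positivity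

/-- Functions which agree after a dilation agree. -/
lemma ae_of_ae_smul {r : ℝ} (hr : r ≠ 0) {P : ℝ × ℝ → Prop} (h : ∀ᵐ p, P (r • p)) :
    ∀ᵐ p, P p := by
  filter_upwards [(quasiMeasurePreserving_smul_real (inv_ne_zero hr)).ae h] with p hp
  rwa [smul_inv_smul₀ hr] at hp

/-- A smooth compactly supported real function on the plane, as a Schwartz function on
spacetime. -/
def planeToSchwartz {g : ℝ × ℝ → ℝ} (hg : ContDiff ℝ (⊤ : ℕ∞) g) (hc : HasCompactSupport g) :
    𝓢(Spacetime, ℂ) :=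
  HasCompactSupport.toSchwartzMap (f := fun x : Spacetime => (g (WithLp.ofLp x) : ℂ))
    ((hc.comp_homeomorph (WithLp.prodContinuousLinearEquiv 2 ℝ ℝ ℝ).toHomeomorph).comp_left
      (g := fun r : ℝ => (r : ℂ)) (by simp))
    (Complex.ofRealCLM.contDiff.comp
      (hg.comp (WithLp.prodContinuousLinearEquiv 2 ℝ ℝ ℝ).contDiff))

lemma planeToSchwartz_apply {g : ℝ × ℝ → ℝ} (hg : ContDiff ℝ (⊤ : ℕ∞) g)
    (hc : HasCompactSupport g) (p : ℝ × ℝ) :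
    planeToSchwartz hg hc (WithLp.toLp 2 p) = g p := rfl

/-- The function representing the Fourier transform is locally integrable. -/
lemma HasSpacetimeFourier.locallyIntegrable {u : 𝓢'(Spacetime, ℂ)} {f : ℝ × ℝ → ℂ}
    (h : HasSpacetimeFourier u f) :
    LocallyIntegrable (fun p : ℝ × ℝ => f ((2 * Real.pi) • p)) := by
  rw [locallyIntegrable_iff]
  intro K hK
  obtain ⟨g, hg1, hgc, hgd⟩ : ∃ g : ℝ × ℝ → ℝ, (∀ x ∈ K, g x = 1) ∧
      HasCompactSupport g ∧ ContDiff ℝ (⊤ : ℕ∞) g := by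
    obtain ⟨R, hR⟩ := hK.isBounded.subset_closedBall 0
    let B : ContDiffBump (0 : ℝ × ℝ) :=
      ⟨max R 1, max R 1 + 1, by positivity, by linarith⟩
    refine ⟨B, fun x hx => B.one_of_mem_closedBall ?_, B.hasCompactSupport, B.contDiff⟩
    exact Metric.closedBall_subset_closedBall (le_max_left _ _) (hR hx)
  have := (h.integrable (planeToSchwartz hgd hgc)).integrableOn (s := K)
  refine this.congr_fun (fun p hp => ?_) hK.measurableSet
  simp [planeToSchwartz_apply, hg1 p hp]

/-- The function representing the Fourier transform is unique up to a null set. -/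
lemma HasSpacetimeFourier.ae_eq {u : 𝓢'(Spacetime, ℂ)} {f g : ℝ × ℝ → ℂ}
    (hf : HasSpacetimeFourier u f) (hg : HasSpacetimeFourier u g) : f =ᵐ[volume] g := by
  refine ae_of_ae_smul two_pi_ne_zero (P := fun p => f p = g p) ?_
  refine ae_eq_of_integral_contDiff_smul_eq hf.locallyIntegrable hg.locallyIntegrable ?_
  intro φ hφ hc
  have h := (hf.fourier_eq (planeToSchwartz hφ hc)).symm.trans
    (hg.fourier_eq (planeToSchwartz hφ hc))
  simpa only [planeToSchwartz_apply, Complex.real_smul, mul_comm] using h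

/-- The Fourier transform turns `∂ₓ` into multiplication by `iξ`. -/
lemma HasSpacetimeFourier.spaceDeriv {w : 𝓢'(Spacetime, ℂ)} {P : ℝ × ℝ → ℂ}
    (h : HasSpacetimeFourier w P) :
    HasSpacetimeFourier (spaceDeriv w) (fun p => Complex.I * p.1 * P p) := by
  set m : Spacetime := WithLp.toLp 2 ((1 : ℝ), (0 : ℝ)) with hm
  have hT : (fun x : Spacetime => ((inner ℝ x m : ℝ) : ℂ)).HasTemperateGrowth := by fun_prop
  have hin : ∀ p : ℝ × ℝ, inner ℝ (WithLp.toLp 2 p : Spacetime) m = p.1 := by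
    intro p; simp [hm, WithLp.prod_inner_apply]
  -- The derivative has symbol `2πiξ` for `𝓕`, and representing functions are evaluated at `2πξ`;
  -- the dilation absorbs the `2π` and leaves `iξ`.
  have key : ∀ (φ : 𝓢(Spacetime, ℂ)) (p : ℝ × ℝ),
      Complex.I * (((2 * Real.pi) • p).1 : ℂ) * P ((2 * Real.pi) • p) * φ (WithLp.toLp 2 p) =
        (2 * Real.pi * Complex.I) * (P ((2 * Real.pi) • p) *
          SchwartzMap.smulLeftCLM ℂ (fun x : Spacetime => ((inner ℝ x m : ℝ) : ℂ)) φ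
            (WithLp.toLp 2 p)) := by
    intro φ p
    rw [SchwartzMap.smulLeftCLM_apply_apply hT, hin]
    simp only [Prod.smul_fst, smul_eq_mul]
    push_cast
    ring
  refine ⟨?_, fun φ => ?_, fun φ => ?_⟩
  · exact AEStronglyMeasurable.mul (by fun_prop) h.aestronglyMeasurable
  · simp only [key]
    exact (h.integrable _).const_mul _
  · simp only [key]
    rw [integral_const_mul, ← h.fourier_eq]
    rw [_root_.spaceDeriv, TemperedDistribution.fourier_lineDerivOp_eq]
    rfl

/-- A function which is integrable against a polynomial weight is the Fourier transform of a
tempered distribution. -/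
lemma exists_hasSpacetimeFourier {P : ℝ × ℝ → ℂ} (hP : AEStronglyMeasurable P)
    {h : ℝ × ℝ → ℝ} (hh : Integrable h) {n : ℕ}
    (hb : ∀ᵐ p : ℝ × ℝ, ‖P ((2 * Real.pi) • p)‖ ≤
      h p * (1 + ‖(WithLp.toLp 2 p : Spacetime)‖) ^ n) :
    ∃ w : 𝓢'(Spacetime, ℂ), HasSpacetimeFourier w P := by
  have hP' : AEStronglyMeasurable fun p : ℝ × ℝ => P ((2 * Real.pi) • p) :=
    hP.comp_quasiMeasurePreserving (quasiMeasurePreserving_smul_real two_pi_ne_zero)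
  have hφm : ∀ φ : 𝓢(Spacetime, ℂ), Continuous fun p : ℝ × ℝ => φ (WithLp.toLp 2 p) :=
    fun φ => φ.continuous.comp (WithLp.prod_continuous_toLp 2 ℝ ℝ)
  set S : 𝓢(Spacetime, ℂ) → ℝ := fun φ => 2 ^ n *
    ((Finset.Iic ((n, 0) : ℕ × ℕ)).sup (fun m => SchwartzMap.seminorm ℂ m.1 m.2)) φ with hS
  have hbd : ∀ φ : 𝓢(Spacetime, ℂ), ∀ᵐ p : ℝ × ℝ,
      ‖P ((2 * Real.pi) • p) * φ (WithLp.toLp 2 p)‖ ≤ S φ * |h p| := by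
    intro φ
    filter_upwards [hb] with p hp
    have h1 : (1 + ‖(WithLp.toLp 2 p : Spacetime)‖) ^ n * ‖φ (WithLp.toLp 2 p)‖ ≤ S φ := by
      simpa using SchwartzMap.one_add_le_sup_seminorm_apply (𝕜 := ℂ) (m := (n, 0)) (k := n)
        (n := 0) le_rfl le_rfl φ (WithLp.toLp 2 p)
    rw [norm_mul]
    calc ‖P ((2 * Real.pi) • p)‖ * ‖φ (WithLp.toLp 2 p)‖
        ≤ |h p| * (1 + ‖(WithLp.toLp 2 p : Spacetime)‖) ^ n * ‖φ (WithLp.toLp 2 p)‖ := by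
          gcongr
          refine hp.trans ?_
          gcongr
          exact le_abs_self _
      _ = |h p| * ((1 + ‖(WithLp.toLp 2 p : Spacetime)‖) ^ n * ‖φ (WithLp.toLp 2 p)‖) := by ring
      _ ≤ |h p| * S φ := by gcongr
      _ = _ := mul_comm _ _
  have hint : ∀ φ : 𝓢(Spacetime, ℂ),
      Integrable fun p : ℝ × ℝ => P ((2 * Real.pi) • p) * φ (WithLp.toLp 2 p) := fun φ =>
    (hh.abs.const_mul (S φ)).mono' (hP'.mul (hφm φ).aestronglyMeasurable) (hbd φ)
  let A : 𝓢(Spacetime, ℂ) →L[ℂ] ℂ :=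
    SchwartzMap.mkCLMtoNormedSpace (σ := RingHom.id ℂ)
      (fun φ => ∫ p : ℝ × ℝ, P ((2 * Real.pi) • p) * φ (WithLp.toLp 2 p))
      (fun φ ψ => by
        rw [← integral_add (hint φ) (hint ψ)]
        simp only [add_apply, mul_add])
      (fun a φ => by
        rw [RingHom.id_apply, smul_eq_mul, ← integral_const_mul]
        simp only [smul_apply, smul_eq_mul, mul_left_comm])
      ⟨Finset.Iic (n, 0), 2 ^ n * ∫ p, |h p|, by positivity, fun φ => by
        calc _ ≤ ∫ p : ℝ × ℝ, S φ * |h p| :=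
              norm_integral_le_of_norm_le (hh.abs.const_mul (S φ)) (hbd φ)
          _ = _ := by
              rw [integral_const_mul]
              exact mul_right_comm _ _ _⟩
  let T : 𝓢'(Spacetime, ℂ) := ContinuousLinearMap.toPointwiseConvergenceCLM _ _ _ _ A
  refine ⟨𝓕⁻ T, hP, hint, fun φ => ?_⟩
  rw [FourierTransform.fourier_fourierInv_eq]
  rfl

/-! ### The bilinear integral and its weighted norms. -/

lemma sq_eLpNorm_two {α : Type*} [MeasurableSpace α] {μ : Measure α} (f : α → ℂ) :
    eLpNorm f 2 μ ^ 2 = ∫⁻ x, ‖f x‖ₑ ^ 2 ∂μ := by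
  rw [eLpNorm_eq_lintegral_rpow_enorm_toReal two_ne_zero ENNReal.ofNat_ne_top,
    ENNReal.toReal_ofNat, ENNReal.sq_rpow_half]
  simp

lemma enorm_bourgainWeight_mul (b : ℝ) (p : ℝ × ℝ) (z : ℂ) :
    ‖(bourgainWeight 0 b p : ℂ) * z‖ₑ = ENNReal.ofReal ((1 + |modulation p|) ^ b) * ‖z‖ₑ := by
  rw [enorm_mul, bourgainWeight, Real.rpow_zero, one_mul, ← ofReal_norm, Complex.norm_real,
    Real.norm_of_nonneg (by positivity)]
  rfl

lemma aestronglyMeasurable_bourgainWeight_mul (s b : ℝ) {f : ℝ × ℝ → ℂ}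
    (hf : AEStronglyMeasurable f) :
    AEStronglyMeasurable fun p => (bourgainWeight s b p : ℂ) * f p := by
  refine AEStronglyMeasurable.mul (Measurable.aestronglyMeasurable ?_) hf
  unfold bourgainWeight
  fun_prop

lemma enorm_bilinearIntegrand (ρ : ℝ) (f g : ℝ × ℝ → ℂ) (p q : ℝ × ℝ) :
    ‖bilinearIntegrand ρ f g p q‖ₑ =
      ENNReal.ofReal (min |p.1 - q.1| |q.1| ^ ρ) * (‖f (p - q)‖ₑ * ‖g q‖ₑ) := by
  rw [bilinearIntegrand, enorm_mul, enorm_mul, mul_assoc, ← ofReal_norm (_ : ℂ),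
    Complex.norm_real, Real.norm_of_nonneg (by positivity)]

lemma aestronglyMeasurable_bilinearIntegrand (ρ : ℝ) {f g : ℝ × ℝ → ℂ}
    (hf : AEStronglyMeasurable f) (hg : AEStronglyMeasurable g) :
    AEStronglyMeasurable (fun z : (ℝ × ℝ) × (ℝ × ℝ) => bilinearIntegrand ρ f g z.1 z.2)
      (volume.prod volume) := by
  unfold bilinearIntegrand
  refine AEStronglyMeasurable.mul (AEStronglyMeasurable.mul ?_ ?_) hg.comp_snd
  · exact Measurable.aestronglyMeasurable (by fun_prop)
  · exact hf.comp_quasiMeasurePreserving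
      (quasiMeasurePreserving_sub_of_right_invariant volume volume)

lemma aestronglyMeasurable_bilinearIntegrand_right (ρ : ℝ) {f g : ℝ × ℝ → ℂ}
    (hf : AEStronglyMeasurable f) (hg : AEStronglyMeasurable g) (p : ℝ × ℝ) :
    AEStronglyMeasurable (bilinearIntegrand ρ f g p) := by
  unfold bilinearIntegrand
  refine AEStronglyMeasurable.mul (AEStronglyMeasurable.mul ?_ ?_) hg
  · exact Measurable.aestronglyMeasurable (by fun_prop)
  · exact hf.comp_quasiMeasurePreserving
      (quasiMeasurePreserving_sub_left_of_right_invariant volume p)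

/-- The bilinear integral converges absolutely off the line `ξ = 0`, with an explicit bound. -/
lemma lintegral_enorm_bilinearIntegrand_le {ρ b : ℝ} (hρ : 0 ≤ ρ) (hb : ρ / 2 ≤ b)
    {f g : ℝ × ℝ → ℂ} (hf : AEStronglyMeasurable f) (hg : AEStronglyMeasurable g)
    {p : ℝ × ℝ} (hp : p.1 ≠ 0) :
    ∫⁻ q, ‖bilinearIntegrand ρ f g p q‖ₑ ≤
      ENNReal.ofReal (|p.1| ^ (-(ρ / 2)) * (1 + |modulation p|) ^ (ρ / 2)) *
        (eLpNorm (fun p => (bourgainWeight 0 b p : ℂ) * f p) 2 volume *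
          eLpNorm (fun p => (bourgainWeight 0 b p : ℂ) * g p) 2 volume) := by
  set F : ℝ × ℝ → ℂ := fun p => (bourgainWeight 0 b p : ℂ) * f p with hF
  set H : ℝ × ℝ → ℂ := fun p => (bourgainWeight 0 b p : ℂ) * g p with hH
  have hFm : AEMeasurable fun q => ‖F (p - q)‖ₑ :=
    ((aestronglyMeasurable_bourgainWeight_mul 0 b hf).comp_quasiMeasurePreserving
      (quasiMeasurePreserving_sub_left_of_right_invariant volume p)).enorm
  have hHm : AEMeasurable fun q => ‖H q‖ₑ :=
    (aestronglyMeasurable_bourgainWeight_mul 0 b hg).enorm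
  have hCS : ∫⁻ q, ‖F (p - q)‖ₑ * ‖H q‖ₑ ≤ eLpNorm F 2 volume * eLpNorm H 2 volume := by
    rw [← (ENNReal.pow_right_strictMono two_ne_zero).le_iff_le]
    rw [mul_pow, sq_eLpNorm_two, sq_eLpNorm_two,
      ← lintegral_sub_left_eq_self (fun q => ‖F q‖ₑ ^ 2) p]
    exact sq_lintegral_mul_le hFm hHm
  calc ∫⁻ q, ‖bilinearIntegrand ρ f g p q‖ₑ
      ≤ ∫⁻ q, ENNReal.ofReal (|p.1| ^ (-(ρ / 2)) * (1 + |modulation p|) ^ (ρ / 2)) *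
          (‖F (p - q)‖ₑ * ‖H q‖ₑ) := by
        refine lintegral_mono fun q => ?_
        rw [enorm_bilinearIntegrand]
        have h := min_rpow_mul_le (x := (p - q).1) (y := q.1) hρ hb (by simpa using hp)
          (modulation_resonance p q)
        simp only [Prod.fst_sub, sub_add_cancel] at h
        simp only [hF, hH, enorm_bourgainWeight_mul]
        calc _ ≤ ENNReal.ofReal (|p.1| ^ (-(ρ / 2)) * (1 + |modulation p|) ^ (ρ / 2) *
              ((1 + |modulation (p - q)|) ^ b * (1 + |modulation q|) ^ b)) *
                (‖f (p - q)‖ₑ * ‖g q‖ₑ) := by gcongr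
          _ = _ := by
            rw [ENNReal.ofReal_mul (by positivity), ENNReal.ofReal_mul (by positivity)]
            rw [ENNReal.ofReal_mul (by positivity)]
            ring
    _ ≤ _ := by
        rw [lintegral_const_mul' _ _ ENNReal.ofReal_ne_top]
        gcongr

lemma enorm_weighted_bilinear_le {ρ b : ℝ} (f g : ℝ × ℝ → ℂ) (p : ℝ × ℝ) :
    ‖(bourgainWeight 0 (b - 1) p : ℂ) *
        (Complex.I * p.1 * ∫ q : ℝ × ℝ, bilinearIntegrand ρ f g p q)‖ₑ ≤
      ∫⁻ q, ENNReal.ofReal (weightedMultiplier ρ b p q) *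
        (‖(bourgainWeight 0 b (p - q) : ℂ) * f (p - q)‖ₑ * ‖(bourgainWeight 0 b q : ℂ) * g q‖ₑ) := by
  have hI : ‖Complex.I * (p.1 : ℂ)‖ₑ = ENNReal.ofReal |p.1| := by
    rw [← ofReal_norm, norm_mul, Complex.norm_I, one_mul, Complex.norm_real, Real.norm_eq_abs]
  rw [enorm_bourgainWeight_mul, enorm_mul, hI, ← mul_assoc]
  calc _ ≤ ENNReal.ofReal ((1 + |modulation p|) ^ (b - 1)) * ENNReal.ofReal |p.1| *
        ∫⁻ q, ‖bilinearIntegrand ρ f g p q‖ₑ := by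
        gcongr
        exact enorm_integral_le_lintegral_enorm _
    _ = _ := by
        rw [← lintegral_const_mul' _ _ (by finiteness)]
        refine lintegral_congr fun q => ?_
        have hcancel : ∀ r : ℝ × ℝ, ENNReal.ofReal ((1 + |modulation r|) ^ (-b)) *
            ENNReal.ofReal ((1 + |modulation r|) ^ b) = 1 := fun r => by
          rw [← ENNReal.ofReal_mul (by positivity), ← Real.rpow_add (by positivity)]
          simp
        rw [enorm_bilinearIntegrand, enorm_bourgainWeight_mul, enorm_bourgainWeight_mul,
          weightedMultiplier]
        simp (disch := positivity) only [ENNReal.ofReal_mul]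
        calc _ = ENNReal.ofReal |p.1| * ENNReal.ofReal ((1 + |modulation p|) ^ (b - 1)) *
              ENNReal.ofReal (min |p.1 - q.1| |q.1| ^ ρ) * (‖f (p - q)‖ₑ * ‖g q‖ₑ) *
              (ENNReal.ofReal ((1 + |modulation (p - q)|) ^ (-b)) *
                ENNReal.ofReal ((1 + |modulation (p - q)|) ^ b)) *
              (ENNReal.ofReal ((1 + |modulation q|) ^ (-b)) *
                ENNReal.ofReal ((1 + |modulation q|) ^ b)) := by
              rw [hcancel, hcancel]
              ring
          _ = _ := by ring

/-- The bilinear estimate for the representing functions. -/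
lemma eLpNorm_weighted_bilinear_le {ρ ε : ℝ} (hρ : 0 ≤ ρ) (hε : 0 < ε) (hε' : ε ≤ 1 / 8)
    (h : 2 * ρ + 12 * ε ≤ 3 / 2) {f g : ℝ × ℝ → ℂ} (hf : AEStronglyMeasurable f)
    (hg : AEStronglyMeasurable g) :
    eLpNorm (fun p => (bourgainWeight 0 ((1 + ε) / 2 - 1) p : ℂ) *
        (Complex.I * p.1 * ∫ q : ℝ × ℝ, bilinearIntegrand ρ f g p q)) 2 volume ≤
      (27 * (64 * kernelBound (1 + ε))) ^ (1 / 2 : ℝ) *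
        eLpNorm (fun p => (bourgainWeight 0 ((1 + ε) / 2) p : ℂ) * f p) 2 volume *
        eLpNorm (fun p => (bourgainWeight 0 ((1 + ε) / 2) p : ℂ) * g p) 2 volume := by
  rw [← (ENNReal.pow_right_strictMono two_ne_zero).le_iff_le]
  rw [mul_pow, mul_pow, ENNReal.sq_rpow_half, sq_eLpNorm_two,
    sq_eLpNorm_two, sq_eLpNorm_two, mul_assoc]
  refine le_trans (lintegral_mono fun p => ?_) (lintegral_sq_weightedMultiplier_le hρ hε hε' h
    (aestronglyMeasurable_bourgainWeight_mul 0 ((1 + ε) / 2) hf).enorm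
    (aestronglyMeasurable_bourgainWeight_mul 0 ((1 + ε) / 2) hg).enorm)
  gcongr
  exact enorm_weighted_bilinear_le f g p

/-! ### Existence of `B_ρ(u, v)` as a tempered distribution. -/

lemma integrable_abs_rpow_mul {r : ℝ} (hr : 0 ≤ r) (hr' : r < 1) :
    Integrable fun x : ℝ => |x| ^ (-r) * (1 + |x|) ^ (-2 : ℝ) := by
  have h1 : Integrable fun x : ℝ => (1 + |x|) ^ (-2 : ℝ) := by
    simpa [Real.norm_eq_abs] using
      integrable_one_add_norm (E := ℝ) (μ := volume) (r := 2) (by simp)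
  have h2 : LocallyIntegrable fun x : ℝ => |x| ^ (-r) :=
    locallyIntegrable_of_norm_le_rpow (C := 1) (α := r) (by simp) (by simpa using hr')
      (.of_forall fun x => by
        rw [Real.norm_of_nonneg (by positivity), one_mul, Real.norm_eq_abs])
      (Measurable.aestronglyMeasurable (by fun_prop))
  have h3 : Integrable ((Metric.closedBall (0 : ℝ) 1).indicator fun x : ℝ => |x| ^ (-r)) :=
    (h2.integrableOn_isCompact (isCompact_closedBall _ _)).integrable_indicator
      Metric.isClosed_closedBall.measurableSet
  refine (h1.add h3).mono' (Measurable.aestronglyMeasurable (by fun_prop)) (.of_forall fun x => ?_)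
  rw [Real.norm_of_nonneg (by positivity), Pi.add_apply]
  have h4 : (1 + |x|) ^ (-2 : ℝ) ≤ 1 :=
    Real.rpow_le_one_of_one_le_of_nonpos (by linarith [abs_nonneg x]) (by norm_num)
  by_cases hx : x ∈ Metric.closedBall (0 : ℝ) 1
  · rw [Set.indicator_of_mem hx]
    have : |x| ^ (-r) * (1 + |x|) ^ (-2 : ℝ) ≤ |x| ^ (-r) * 1 := by gcongr
    have : 0 ≤ (1 + |x|) ^ (-2 : ℝ) := by positivity
    linarith
  · rw [Set.indicator_of_notMem hx, add_zero]
    have hx1 : 1 ≤ |x| := by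
      rw [mem_closedBall_zero_iff, Real.norm_eq_abs] at hx; linarith
    calc _ ≤ 1 * (1 + |x|) ^ (-2 : ℝ) := by
          gcongr
          exact Real.rpow_le_one_of_one_le_of_nonpos hx1 (by linarith)
      _ = _ := one_mul _

lemma ae_fst_ne_zero : ∀ᵐ p : ℝ × ℝ, p.1 ≠ 0 :=
  Measure.quasiMeasurePreserving_fst.ae (μa := volume) (p := fun x : ℝ => x ≠ 0)
    (Measure.ae_ne volume 0)

/-- The bilinear operator is defined on pairs of functions in weighted `L²`. -/
lemma exists_isBilinear {ρ b : ℝ} (hρ : 0 ≤ ρ) (hρ' : ρ < 2) (hb : ρ / 2 ≤ b)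
    {u v : 𝓢'(Spacetime, ℂ)} {f g : ℝ × ℝ → ℂ} (hf : HasSpacetimeFourier u f)
    (hg : HasSpacetimeFourier v g)
    (hfb : eLpNorm (fun p => (bourgainWeight 0 b p : ℂ) * f p) 2 volume < ∞)
    (hgb : eLpNorm (fun p => (bourgainWeight 0 b p : ℂ) * g p) 2 volume < ∞) :
    ∃ w : 𝓢'(Spacetime, ℂ), IsBilinear ρ u v w := by
  set N : ℝ≥0∞ := eLpNorm (fun p => (bourgainWeight 0 b p : ℂ) * f p) 2 volume *
          eLpNorm (fun p => (bourgainWeight 0 b p : ℂ) * g p) 2 volume with hN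
  have hNtop : N ≠ ∞ := by finiteness
  have hfm := hf.aestronglyMeasurable
  have hgm := hg.aestronglyMeasurable
  have hbound : ∀ p : ℝ × ℝ, p.1 ≠ 0 → ∫⁻ q, ‖bilinearIntegrand ρ f g p q‖ₑ ≤
      ENNReal.ofReal (|p.1| ^ (-(ρ / 2)) * (1 + |modulation p|) ^ (ρ / 2)) * N :=
    fun p hp => lintegral_enorm_bilinearIntegrand_le hρ hb hfm hgm hp
  have hnorm : ∀ p : ℝ × ℝ, p.1 ≠ 0 → ‖∫ q : ℝ × ℝ, bilinearIntegrand ρ f g p q‖ ≤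
      |p.1| ^ (-(ρ / 2)) * (1 + |modulation p|) ^ (ρ / 2) * N.toReal := by
    intro p hp
    have h1 := (enorm_integral_le_lintegral_enorm _).trans (hbound p hp)
    have h2 := ENNReal.toReal_mono (by finiteness) h1
    rwa [toReal_enorm, ENNReal.toReal_mul, ENNReal.toReal_ofReal (by positivity)] at h2
  have hPm : AEStronglyMeasurable fun p => ∫ q : ℝ × ℝ, bilinearIntegrand ρ f g p q :=
    (aestronglyMeasurable_bilinearIntegrand ρ hfm hgm).integral_prod_right'
  obtain ⟨c, hc⟩ : ∃ c, c = 2 * Real.pi := ⟨_, rfl⟩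
  have hc1 : 1 ≤ c := by rw [hc]; linarith [Real.two_le_pi]
  have hh : Integrable fun p : ℝ × ℝ => (c ^ 3 * N.toReal) *
      ((|p.1| ^ (-(ρ / 2)) * (1 + |p.1|) ^ (-2 : ℝ)) * (1 + |p.2|) ^ (-2 : ℝ)) := by
    refine Integrable.const_mul ?_ _
    have h2 : Integrable fun x : ℝ => (1 + |x|) ^ (-2 : ℝ) := by
      simpa [Real.norm_eq_abs] using
        integrable_one_add_norm (E := ℝ) (μ := volume) (r := 2) (by simp)
    exact (integrable_abs_rpow_mul (r := ρ / 2) (by linarith) (by linarith)).mul_prod h2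
  -- The exponent is `8 = 3 + 1 + 2 + 2`: growth `(1 + |ξ|)³(1 + |τ|)` from the modulation, and two
  -- powers in each variable to compensate the integrable weights in `hh`.
  obtain ⟨w, hw⟩ := exists_hasSpacetimeFourier hPm hh (n := 8) (by
    filter_upwards [ae_fst_ne_zero] with p hp
    rw [← hc]
    have hc0 : 0 ≤ c := by linarith
    have hcp : (c • p).1 ≠ 0 := by
      simpa [hp] using (by linarith : 0 < c).ne'
    refine (hnorm (c • p) hcp).trans ?_
    have h1 : |p.1| ≤ ‖(WithLp.toLp 2 p : Spacetime)‖ := WithLp.norm_fst_le ℝ (WithLp.toLp 2 p : Spacetime)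
    have h2 : |p.2| ≤ ‖(WithLp.toLp 2 p : Spacetime)‖ := WithLp.norm_snd_le ℝ (WithLp.toLp 2 p : Spacetime)
    set R := ‖(WithLp.toLp 2 p : Spacetime)‖ with hR
    have h3 : |(c • p).1| ^ (-(ρ / 2)) ≤ |p.1| ^ (-(ρ / 2)) := by
      refine Real.rpow_le_rpow_of_nonpos (abs_pos.2 hp) ?_ (by linarith)
      rw [Prod.smul_fst, smul_eq_mul, abs_mul, abs_of_nonneg hc0]
      nlinarith [abs_nonneg p.1]
    have h4 : (1 + |modulation (c • p)|) ^ (ρ / 2) ≤ c ^ 3 * ((1 + |p.1|) ^ 3 * (1 + |p.2|)) := by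
      have h5 : |modulation (c • p)| ≤ c * |p.2| + c ^ 3 * |p.1| ^ 3 := by
        rw [modulation]
        refine (abs_sub _ _).trans (le_of_eq ?_)
        rw [Prod.smul_fst, Prod.smul_snd, smul_eq_mul, smul_eq_mul, abs_pow, abs_mul, abs_mul,
          abs_of_nonneg hc0, mul_pow]
      have h6 : c ≤ c ^ 3 := le_self_pow₀ hc1 (by norm_num)
      have h7 : 1 ≤ c ^ 3 := hc1.trans h6
      calc (1 + |modulation (c • p)|) ^ (ρ / 2) ≤ (1 + |modulation (c • p)|) ^ (1 : ℝ) :=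
            Real.rpow_le_rpow_of_exponent_le (by linarith [abs_nonneg (modulation (c • p))])
              (by linarith)
        _ = 1 + |modulation (c • p)| := Real.rpow_one _
        _ ≤ c ^ 3 + (c ^ 3 * |p.2| + c ^ 3 * |p.1| ^ 3) := by
            gcongr
            exact h5.trans (by gcongr)
        _ = c ^ 3 * (1 + |p.2| + |p.1| ^ 3) := by ring
        _ ≤ _ := by
            gcongr
            have : 0 ≤ |p.1| := abs_nonneg _
            have : 0 ≤ |p.2| := abs_nonneg _
            have : 1 + |p.1| ^ 3 ≤ (1 + |p.1|) ^ 3 := by nlinarith [sq_nonneg |p.1|]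
            nlinarith [pow_nonneg (abs_nonneg p.1) 3]
    have h8 : ∀ x : ℝ, (1 + |x|) ^ (-2 : ℝ) * (1 + |x|) ^ 2 = 1 := fun x => by
      rw [Real.rpow_neg (by positivity)]
      norm_cast
      exact inv_mul_cancel₀ (by positivity)
    calc _ ≤ |p.1| ^ (-(ρ / 2)) * (c ^ 3 * ((1 + |p.1|) ^ 3 * (1 + |p.2|))) * N.toReal := by
          gcongr
      _ = c ^ 3 * N.toReal * (|p.1| ^ (-(ρ / 2)) *
            ((1 + |p.1|) ^ (-2 : ℝ) * (1 + |p.1|) ^ 2) *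
            ((1 + |p.2|) ^ (-2 : ℝ) * (1 + |p.2|) ^ 2)) * ((1 + |p.1|) ^ 3 * (1 + |p.2|)) := by
          rw [h8, h8]; ring
      _ = c ^ 3 * N.toReal * ((|p.1| ^ (-(ρ / 2)) * (1 + |p.1|) ^ (-2 : ℝ)) *
            (1 + |p.2|) ^ (-2 : ℝ)) * ((1 + |p.1|) ^ 5 * (1 + |p.2|) ^ 3) := by
          ring
      _ ≤ c ^ 3 * N.toReal * ((|p.1| ^ (-(ρ / 2)) * (1 + |p.1|) ^ (-2 : ℝ)) *
            (1 + |p.2|) ^ (-2 : ℝ)) * ((1 + R) ^ 5 * (1 + R) ^ 3) := by gcongr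
      _ = _ := by ring)
  refine ⟨w, f, g, hf, hg, ?_, hw⟩
  filter_upwards [ae_fst_ne_zero] with p hp
  exact ⟨aestronglyMeasurable_bilinearIntegrand_right ρ hfm hgm p,
    (hbound p hp).trans_lt (by finiteness)⟩

/-! ### Norms through representing functions, and the conclusion. -/

/-- Any representing function computes the norm. -/
lemma bourgainNorm_eq {s b : ℝ} {u : 𝓢'(Spacetime, ℂ)} {f : ℝ × ℝ → ℂ}
    (hf : HasSpacetimeFourier u f) :
    bourgainNorm s b u = eLpNorm (fun p => (bourgainWeight s b p : ℂ) * f p) 2 volume := by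
  refine le_antisymm (iInf₂_le f hf) (le_iInf₂ fun g hg => le_of_eq ?_)
  refine eLpNorm_congr_ae ?_
  filter_upwards [hf.ae_eq hg] with p hp
  rw [hp]

lemma exists_hasSpacetimeFourier_of_mem {s b : ℝ} {u : 𝓢'(Spacetime, ℂ)}
    (hu : u ∈ bourgainSpace s b) :
    ∃ f, HasSpacetimeFourier u f ∧
      eLpNorm (fun p => (bourgainWeight s b p : ℂ) * f p) 2 volume < ∞ := by
  obtain ⟨f, hf⟩ := iInf_lt_iff.1 (show bourgainNorm s b u < ∞ from hu)
  obtain ⟨hf, hlt⟩ := iInf_lt_iff.1 hf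
  exact ⟨f, hf, hlt⟩

end

theorem corollary2 (ρ : ℝ) (hρ₀ : 0 ≤ ρ) (hρ₁ : ρ < 3 / 4) :
    ∃ b C : ℝ, 1 / 2 < b ∧ b < 1 ∧ 0 < C ∧
      ∀ u ∈ bourgainSpace 0 b, ∀ v ∈ bourgainSpace 0 b,
        (∃ w : 𝓢'(Spacetime, ℂ), IsBilinear ρ u v w) ∧
        ∀ w : 𝓢'(Spacetime, ℂ), IsBilinear ρ u v w →
          bourgainNorm 0 (b - 1) (spaceDeriv w) ≤
            ENNReal.ofReal C * bourgainNorm 0 b u * bourgainNorm 0 b v := by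
  -- This choice gives equality in `2ρ + 12ε ≤ 3/2`, and `ρ ≥ 0` gives `ε ≤ 1/8`.
  obtain ⟨ε, hε⟩ : ∃ ε, ε = (3 / 4 - ρ) / 6 := ⟨_, rfl⟩
  have hε0 : 0 < ε := by rw [hε]; linarith
  have hε8 : ε ≤ 1 / 8 := by rw [hε]; linarith
  have hρε : 2 * ρ + 12 * ε ≤ 3 / 2 := by rw [hε]; linarith
  have hK : (27 * (64 * kernelBound (1 + ε))) ^ (1 / 2 : ℝ) ≠ ∞ := by
    have := kernelBound_ne_top (γ := 1 + ε) (by linarith)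
    finiteness
  -- The `+ 1` only makes positivity of `C` immediate.
  refine ⟨(1 + ε) / 2, ((27 * (64 * kernelBound (1 + ε))) ^ (1 / 2 : ℝ)).toReal + 1,
    by linarith, by linarith, by positivity, fun u hu v hv => ⟨?_, ?_⟩⟩
  · obtain ⟨f, hf, hfb⟩ := exists_hasSpacetimeFourier_of_mem hu
    obtain ⟨g, hg, hgb⟩ := exists_hasSpacetimeFourier_of_mem hv
    exact exists_isBilinear hρ₀ (by linarith) (by linarith) hf hg hfb hgb
  · rintro w ⟨f, g, hf, hg, -, hw⟩
    rw [bourgainNorm_eq hw.spaceDeriv, bourgainNorm_eq hf, bourgainNorm_eq hg]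
    refine (eLpNorm_weighted_bilinear_le hρ₀ hε0 hε8 hρε hf.aestronglyMeasurable
      hg.aestronglyMeasurable).trans ?_
    gcongr
    rw [← ENNReal.ofReal_toReal hK]
    exact ENNReal.ofReal_le_ofReal (by simp)
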